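/- Let $F$ be a field of characteristic $p>0$, let $n\ge 0$ be an integer, and let $\mathcal Q$ be one of the following two ranked posets: (i) (subset case) $\mathcal Q=\mathcal P(n,1)$, the lattice of all subsets of an $n$-element set $\Omega$, ranked by cardinality; in this case put $\pi=p$; (ii) (projective case) $\mathcal Q=\mathcal P(n,q)$, the lattice of all subspaces of an $n$-dimensional vector space over the field with $q$ elements, ranked by dimension, where $p\nmid q$; in this case let $\pi=\pi(p,q)$ be the least integer $i>0$ such that $1+q+q^2+\dots+q^{i-1}\equiv 0 \pmod p$. For $k\in\mathbb Z$ let $\mathcal Q_k$ be the set of elements of rank $k$ in $\mathcal Q$ (so $\mathcal Q_k=\emptyset$ unless $0\le k\le n$). Let $G$ be a group of order automorphisms of $\mathcal Q$, let $U$ be an irreducible $FG$-module, and let $c_k$ be the multiplicity of $U$ as a composition factor of the permutation module $F\mathcal Q_k$ (the $F$-vector space with basis $\mathcal Q_k$, on which $G$ acts by permuting the basis). Write $$[c_k]_\pi:=\sum_{t\in\mathbb Z}c_{k+t\pi}.$$ Then $c_k=c_{n-k}$ for all $k\in\mathbb Z$, and $$[c_m]_\pi\ \ge\ [c_{m-1}]_\pi\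 \ge\ [c_{m-2}]_\pi\ \ge\ \cdots\ \ge\ [c_{m-s}]_\pi\ \ge\ 0,$$ where $m=\lfloor n/2\rfloor$ and $s=\lfloor \pi/2\rfloor$. Moreover, if $\pi>n$, then $[c_k]_\pi=c_k$ for $0\le k\le n$, and Stanley's inequality holds: $c_k\le c_l$ whenever $k\le l$ and $k+l\le n$. -/

import Mathlib

/-!  Composition multiplicities -/

/-- The number of factors `s (i+1) / s i` of the composition series `s` of submodules of `M`
that are isomorphic to `U` as `R`-modules. -/
noncomputable def factorCount {R M : Type*} (U : Type*) [Ring R] [AddCommGroup M] [Module R M]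
    [AddCommGroup U] [Module R U] (s : CompositionSeries (Submodule R M)) : ℕ :=
  Nat.card {i : Fin s.length //
    Nonempty ((s i.succ ⧸ (s i.castSucc).comap (s i.succ).subtype) ≃ₗ[R] U)}

/-- Jordan-Hölder: the number of factors isomorphic to `U` does not depend on the composition
series. -/
theorem factorCount_eq {R M U : Type*} [Ring R] [AddCommGroup M] [Module R M]
    [AddCommGroup U] [Module R U] (s t : CompositionSeries (Submodule R M))
    (hb : s.head = t.head) (ht : s.last = t.last) : factorCount U s = factorCount U t := by
  obtain ⟨f, hf⟩ := CompositionSeries.jordan_holder s t hb ht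
  refine Nat.card_congr (f.subtypeEquiv fun i => ?_)
  have e := JordanHolderLattice.Iso.linearEquiv (hf i)
  exact ⟨fun ⟨g⟩ => ⟨e.symm.trans g⟩, fun ⟨g⟩ => ⟨e.trans g⟩⟩

open Classical in
/-- The multiplicity `c(M, U)` of `U` in `M`: the number of factors isomorphic to `U` in a
composition series `0 = s₀ < s₁ < ⋯ < M` (and `0` if `M` has no composition series). -/
noncomputable def multiplicityIn (R M U : Type*) [Ring R] [AddCommGroup M] [Module R M]
    [AddCommGroup U] [Module R U] : ℕ :=
  if h : ∃ s : CompositionSeries (Submodule R M), s.head = ⊥ ∧ s.last = ⊤ then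
    factorCount U h.choose
  else 0

/-- The multiplicity can be computed from any composition series. -/
theorem multiplicityIn_eq {R M U : Type*} [Ring R] [AddCommGroup M] [Module R M]
    [AddCommGroup U] [Module R U] (s : CompositionSeries (Submodule R M))
    (hb : s.head = ⊥) (ht : s.last = ⊤) : multiplicityIn R M U = factorCount U s := by
  have h : ∃ s : CompositionSeries (Submodule R M), s.head = ⊥ ∧ s.last = ⊤ := ⟨s, hb, ht⟩
  rw [multiplicityIn, dif_pos h]
  exact factorCount_eq _ _ (h.choose_spec.1.trans hb.symm) (h.choose_spec.2.trans ht.symm)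

/-!  The rank sets of the two posets, with the action of the group of all order automorphisms -/

/-- Order automorphisms of the Boolean lattice preserve the size of subsets. -/
theorem card_orderIso_apply {Ω : Type*} [Fintype Ω] (g : Finset Ω ≃o Finset Ω) (x : Finset Ω) :
    (g x).card = x.card := by
  classical
  have h : (Finset.Iic (g x)).card = (Finset.Iic x).card :=
    Finset.card_equiv g.symm.toEquiv fun y => by
      simp [OrderIso.symm_apply_le]
  rw [Finset.card_Iic_finset, Finset.card_Iic_finset] at h
  exact Nat.pow_right_injective le_rfl h

/-- Order automorphisms of the lattice of subspaces preserve the dimension. -/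
theorem finrank_orderIso_apply {K V : Type*} [Field K] [AddCommGroup V] [Module K V]
    [FiniteDimensional K V] (g : Submodule K V ≃o Submodule K V) (x : Submodule K V) :
    Module.finrank K (g x) = Module.finrank K x := by
  have h : Module.length K (g x) = Module.length K x := by
    rw [Module.length_submodule, Module.length_submodule, Order.height_orderIso]
  rw [Module.length_eq_finrank, Module.length_eq_finrank] at h
  exact_mod_cast h

/-- The `k`-element subsets of `Ω`, with the action of the automorphism group of the Boolean
lattice of all subsets of `Ω`; empty unless `0 ≤ k ≤ |Ω|`. -/
def subsetsOfCard (Ω : Type*) [Fintype Ω] (k : ℤ) :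
    SubMulAction (Finset Ω ≃o Finset Ω) (Finset Ω) where
  carrier := {x | (x.card : ℤ) = k}
  smul_mem' g x hx := by
    have h : (g • x).card = x.card := card_orderIso_apply g x
    exact (congrArg Nat.cast h).trans hx

/-- The `k`-dimensional subspaces of `V`, with the action of the automorphism group of the
lattice of all subspaces of `V`; empty unless `0 ≤ k ≤ dim V`. -/
def subspacesOfDim (K V : Type*) [Field K] [AddCommGroup V] [Module K V]
    [FiniteDimensional K V] (k : ℤ) :
    SubMulAction (Submodule K V ≃o Submodule K V) (Submodule K V) where
  carrier := {x | (Module.finrank K x : ℤ) = k}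
  smul_mem' g x hx := by
    have h : Module.finrank K (g • x : Submodule K V) = Module.finrank K x :=
      finrank_orderIso_apply g x
    exact (congrArg Nat.cast h).trans hx

/-! Multiplicities in the permutation modules -/

/-- The permutation module `F X` of the `G`-set `X`, as a module over the group algebra `F G`. -/
abbrev PermModule (F G X : Type*) [Field F] [Group G] [MulAction G X] : Type _ :=
  (Representation.ofMulAction F G X).asModule

/-- `k ↦ c_k`: the multiplicity of `U` in the permutation module on the `k`-subsets of `Ω`. -/
noncomputable def subsetMult (F : Type*) [Field F] {Ω : Type*} [Fintype Ω]
    (G : Subgroup (Finset Ω ≃o Finset Ω)) (U : Type*) [AddCommGroup U]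
    [Module (MonoidAlgebra F G) U] (k : ℤ) : ℤ :=
  multiplicityIn (MonoidAlgebra F G) (PermModule F G (subsetsOfCard Ω k)) U

/-- `k ↦ c_k`: the multiplicity of `U` in the permutation module on the `k`-dimensional
subspaces of `V`. -/
noncomputable def subspaceMult (F : Type*) [Field F] {K V : Type*} [Field K] [AddCommGroup V]
    [Module K V] [FiniteDimensional K V] (G : Subgroup (Submodule K V ≃o Submodule K V))
    (U : Type*) [AddCommGroup U] [Module (MonoidAlgebra F G) U] (k : ℤ) : ℤ :=
  multiplicityIn (MonoidAlgebra F G) (PermModule F G (subspacesOfDim K V k)) U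

/-! Quantum characteristic and periodised sums -/

/-- `π(p,q)`: the least integer `i > 0` with `1 + q + ⋯ + q^(i-1) ≡ 0 mod p`. -/
noncomputable def quantumChar (p q : ℕ) : ℕ :=
  sInf {i : ℕ | 0 < i ∧ p ∣ ∑ j ∈ Finset.range i, q ^ j}

/-- `[c_k]_π = ∑_{t ∈ ℤ} c_{k + tπ}`, for functions `c` of finite support and `π > 0`. -/
noncomputable def periodSum (c : ℤ → ℤ) (π : ℕ) (k : ℤ) : ℤ :=
  ∑ᶠ t : ℤ, c (k + t * π)

/-!
Both posets are finite modular lattices with a rank function for which points are counted by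
powers of `q` (`IsQRank`, with `q = 1` in the Boolean case), and everything below uses only this.

Let `D = down` send an element to the sum of the elements that it covers. Then `D ^ π = 0` over
`F`. Put `M k` for the permutation module on the elements of rank `k`. The heart of the proof is
`IsQRank.exactBelow`: for `i + j = π`, an element of `M k` killed by `D ^ i` lies in the image of
`D ^ j`, unless `2 * k - i < n < 2 * k + j`. It is proved for the functions below any element `W`,
by induction on the rank of `W`. Fix a hyperplane `H` of `W` and consider the projection
`x ↦ x ⊓ H` of the elements of `W` outside `H`.
* Functions that are constant on its fibres, together with the functions below `H`, behave like
  the tensor product of the functions below `H` with a chain of length two; exactness follows by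
  a direct computation from exactness below `H` (`IsQRank.exists_down_pow_eq_add_pull`).
* Modulo these, a function is recovered, up to a unit of `F`, from its fibre sums over the other
  hyperplanes `H'` of `W` (`IsQRank.sum_relPush`, an inverse Radon transform). These are functions
  below `H ⊓ H'`, which has corank two in `W`, and after a correction taking them commutes with `D`
  up to the factor `q` (`IsQRank.relPush_down`). So exactness in corank two applies
  (`IsQRank.exists_smul_sub_down_pow_eq`). In the Boolean case the fibres are singletons and this
  part is void.

Multiplicities are additive on short exact sequences (`multiplicityIn_of_exact`). Splitting each
`c_k` into the parts from the kernel and the image of `D`, exactness of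
`M k → M (k - 1) → M (k - π)`, with maps `D` and `D ^ (π - 1)`, at all `k` of the residue class
of `m - j`, where `m = ⌊n / 2⌋`, gives the inequality between the sums over two adjacent residue
classes (`exists_rankMult_decomposition`, `periodSum_le_of_decomposition`).

The symmetry `c_k = c_{n-k}` comes from the relation `x ⊓ y = ⊥`. Its matrix is invertible over `F`
because the Möbius function takes values `± q ^ i` on the intervals `[⊥, z]`
(`IsQRank.sum_moebius`), and it maps the functions on ranks `≥ k` to functions on ranks `≤ n - k`.
With the dual relation `x ⊔ y = ⊤`, the multiplicities of these two modules agree for every `k`.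
-/

/-! ### Multiplicities and short exact sequences -/

section Multiplicity

variable {R : Type*} [Ring R]

/-- The number of factors isomorphic to `U` is additive under concatenation of series. -/
theorem factorCount_smash {M : Type*} (U : Type*) [AddCommGroup M] [Module R M] [AddCommGroup U]
    [Module R U] (s t : CompositionSeries (Submodule R M)) (h : s.last = t.head) :
    factorCount U (RelSeries.smash s t h) = factorCount U s + factorCount U t := by
  unfold factorCount
  rw [← Nat.card_sum]
  let P : Submodule R M → Submodule R M → Prop := fun A B =>
    Nonempty ((B ⧸ A.comap B.subtype) ≃ₗ[R] U)
  refine Nat.card_congr ((finSumFinEquiv.symm.subtypeEquiv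
    (q := fun i : Fin s.length ⊕ Fin t.length => Sum.elim
      (fun i => P (s i.castSucc) (s i.succ)) (fun i => P (t i.castSucc) (t i.succ)) i)
    ?_).trans Equiv.subtypeSum)
  intro i
  obtain ⟨i | i, rfl⟩ := finSumFinEquiv.surjective i
  · rw [Equiv.symm_apply_apply, finSumFinEquiv_apply_left]
    exact iff_of_eq (congrArg₂ P (RelSeries.smash_castAdd h i) (RelSeries.smash_succ_castAdd h i))
  · rw [Equiv.symm_apply_apply, finSumFinEquiv_apply_right]
    exact iff_of_eq (congrArg₂ P (RelSeries.smash_natAdd h i) (RelSeries.smash_succ_natAdd h i))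

/-- Two series, possibly in different modules, with isomorphic factors in the same order contain
`U` equally often. -/
theorem factorCount_map {M N U : Type*} [AddCommGroup M] [Module R M] [AddCommGroup N]
    [Module R N] [AddCommGroup U] [Module R U] (s : CompositionSeries (Submodule R N))
    (t : CompositionSeries (Submodule R M)) (hl : s.length = t.length)
    (e : ∀ i : Fin s.length, Nonempty ((s i.succ ⧸ (s i.castSucc).comap (s i.succ).subtype) ≃ₗ[R]
      (t (i.cast hl).succ ⧸ (t (i.cast hl).castSucc).comap (t (i.cast hl).succ).subtype))) :
    factorCount U s = factorCount U t :=
  Nat.card_congr ((finCongr hl).subtypeEquiv fun i => by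
    obtain ⟨f⟩ := e i
    exact ⟨fun ⟨g⟩ => ⟨f.symm.trans g⟩, fun ⟨g⟩ => ⟨f.trans g⟩⟩)

theorem nonempty_quotient_map_equiv {M N : Type*} [AddCommGroup M] [Module R M] [AddCommGroup N]
    [Module R N] (f : N →ₗ[R] M) (hf : Function.Injective f) (A B : Submodule R N) :
    Nonempty ((B ⧸ A.comap B.subtype) ≃ₗ[R]
      (B.map f ⧸ (A.map f).comap (B.map f).subtype)) := by
  refine ⟨Submodule.Quotient.equiv _ _ (B.equivMapOfInjective f hf) ?_⟩
  ext ⟨x, hx⟩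
  obtain ⟨b, hb, rfl⟩ := hx
  simp only [Submodule.mem_map, Submodule.mem_comap, Submodule.subtype_apply]
  constructor
  · rintro ⟨y, hy, h⟩
    refine ⟨y, hy, ?_⟩
    exact congrArg Subtype.val h
  · rintro ⟨y, hy, h⟩
    obtain rfl := hf h
    exact ⟨⟨y, hb⟩, hy, Subtype.ext rfl⟩

theorem nonempty_quotient_comap_equiv {M N : Type*} [AddCommGroup M] [Module R M] [AddCommGroup N]
    [Module R N] (f : M →ₗ[R] N) (hf : Function.Surjective f) (A B : Submodule R N) :
    Nonempty ((B ⧸ A.comap B.subtype) ≃ₗ[R]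
      (B.comap f ⧸ (A.comap f).comap (B.comap f).subtype)) := by
  let φ : B.comap f →ₗ[R] B ⧸ A.comap B.subtype :=
    (A.comap B.subtype).mkQ ∘ₗ f.restrict (p := B.comap f) (q := B) fun _ h => h
  have hφ : Function.Surjective φ := by
    refine (Submodule.mkQ_surjective _).comp ?_
    rintro ⟨b, hb⟩
    obtain ⟨a, rfl⟩ := hf b
    exact ⟨⟨a, hb⟩, rfl⟩
  have hk : LinearMap.ker φ = (A.comap f).comap (B.comap f).subtype := by
    ext x
    simp [φ, LinearMap.mem_ker, Submodule.Quotient.mk_eq_zero]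
  exact ⟨((Submodule.quotEquivOfEq _ _ hk.symm).trans (φ.quotKerEquivOfSurjective hφ)).symm⟩

theorem exists_compositionSeries_top (R M : Type*) [Ring R] [AddCommGroup M] [Module R M]
    [IsNoetherian R M] [IsArtinian R M] :
    ∃ s : CompositionSeries (Submodule R M), s.head = ⊥ ∧ s.last = ⊤ :=
  exists_compositionSeries_of_isNoetherian_isArtinian R M

/-- Multiplicities are additive on short exact sequences: composition series of the two ends
combine to one of the middle term. -/
theorem multiplicityIn_of_exact {M N K : Type*} (U : Type*) [AddCommGroup M] [Module R M]
    [AddCommGroup N] [Module R N] [AddCommGroup K] [Module R K] [AddCommGroup U] [Module R U]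
    [IsNoetherian R N] [IsArtinian R N] [IsNoetherian R K] [IsArtinian R K]
    (f : N →ₗ[R] M) (g : M →ₗ[R] K) (hf : Function.Injective f) (hg : Function.Surjective g)
    (h : LinearMap.range f = LinearMap.ker g) :
    multiplicityIn R M U = multiplicityIn R N U + multiplicityIn R K U := by
  obtain ⟨s, hs, hs'⟩ := exists_compositionSeries_top R N
  obtain ⟨t, ht, ht'⟩ := exists_compositionSeries_top R K
  let s' : CompositionSeries (Submodule R M) := RelSeries.map s
    ⟨Submodule.map f, fun {A B} (hAB : A ⋖ B) => by
      refine (?_ : A.map f ⋖ B.map f)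
      refine ⟨Submodule.map_strictMono_of_injective hf hAB.lt, fun C hAC hCB => ?_⟩
      have hC : (C.comap f).map f = C := by
        rw [Submodule.map_comap_eq, inf_eq_right]
        exact hCB.le.trans LinearMap.map_le_range
      rw [← hC] at hAC hCB
      exact hAB.2 ((Submodule.map_lt_map_iff_of_injective hf).1 hAC)
        ((Submodule.map_lt_map_iff_of_injective hf).1 hCB)⟩
  let t' : CompositionSeries (Submodule R M) := RelSeries.map t
    ⟨Submodule.comap g, fun {A B} (hAB : A ⋖ B) => by
      refine (?_ : A.comap g ⋖ B.comap g)
      refine ⟨Submodule.comap_strictMono_of_surjective hg hAB.lt, fun C hAC hCB => ?_⟩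
      have hC : (C.map g).comap g = C := by
        rw [Submodule.comap_map_eq, sup_eq_left]
        exact (Submodule.comap_mono bot_le).trans hAC.le
      rw [← hC] at hAC hCB
      exact hAB.2 ((Submodule.comap_lt_comap_iff_of_surjective hg).1 hAC)
        ((Submodule.comap_lt_comap_iff_of_surjective hg).1 hCB)⟩
  have hst : s'.last = t'.head := by
    change s.last.map f = t.head.comap g
    rw [hs', ht, Submodule.map_top, h]
    rfl
  have h1 : (RelSeries.smash s' t' hst).head = ⊥ := by
    rw [RelSeries.head_smash]
    change s.head.map f = ⊥
    rw [hs, Submodule.map_bot]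
  have h2 : (RelSeries.smash s' t' hst).last = ⊤ := by
    rw [RelSeries.last_smash]
    change t.last.comap g = ⊤
    rw [ht', Submodule.comap_top]
  rw [multiplicityIn_eq _ h1 h2, factorCount_smash, multiplicityIn_eq s hs hs',
    multiplicityIn_eq t ht ht']
  congr 1
  · exact (factorCount_map s s' rfl fun i => nonempty_quotient_map_equiv f hf _ _).symm
  · exact (factorCount_map t t' rfl fun i => nonempty_quotient_comap_equiv g hg _ _).symm

theorem multiplicityIn_of_subsingleton (M U : Type*) [AddCommGroup M] [Module R M]
    [AddCommGroup U] [Module R U] [Subsingleton M] : multiplicityIn R M U = 0 := by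
  have h := multiplicityIn_of_exact U (LinearMap.id : M →ₗ[R] M) (LinearMap.id : M →ₗ[R] M)
    Function.injective_id Function.surjective_id (Subsingleton.elim _ _)
  omega

variable {M N K : Type*} [AddCommGroup M] [Module R M] [AddCommGroup N] [Module R N]
  [IsNoetherian R M] [IsArtinian R M] (U : Type*) [AddCommGroup U] [Module R U]

theorem multiplicityIn_eq_ker_add_range (f : M →ₗ[R] N) :
    multiplicityIn R M U =
      multiplicityIn R (LinearMap.ker f) U + multiplicityIn R (LinearMap.range f) U :=
  multiplicityIn_of_exact U (LinearMap.ker f).subtype f.rangeRestrict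
    (Submodule.subtype_injective _) f.surjective_rangeRestrict (by simp)

theorem multiplicityIn_le_of_injective [IsNoetherian R N] [IsArtinian R N] (f : M →ₗ[R] N)
    (hf : Function.Injective f) :
    multiplicityIn R M U ≤ multiplicityIn R N U := by
  rw [multiplicityIn_of_exact (M := N) U f (LinearMap.range f).mkQ hf (Submodule.mkQ_surjective _)
    (by simp)]
  exact Nat.le_add_right _ _

theorem multiplicityIn_mono {A B : Submodule R M} (h : A ≤ B) :
    multiplicityIn R A U ≤ multiplicityIn R B U :=
  multiplicityIn_le_of_injective U (Submodule.inclusion h) (Submodule.inclusion_injective h)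

end Multiplicity

/-! ### Modular lattices with `q`-counts -/

/-- A rank function `r` on a bounded lattice for which the number of points is that of a
projective geometry of order `q` (of a Boolean lattice, if `q = 1`): if `H` is covered by `W` and
`y ≤ H`, then `q ^ (r H - r y)` of the elements `x ≤ W` that cover `y` are not below `H`. -/
structure IsQRank {L : Type*} [Lattice L] [BoundedOrder L] (r : L → ℕ) (q : ℕ) : Prop where
  strictMono : StrictMono r
  map_bot : r ⊥ = 0
  covBy : ∀ {x y : L}, x ⋖ y → r y = r x + 1
  ncard_covers : ∀ {y H W : L}, y ≤ H → H ⋖ W →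
    {x : L | y ⋖ x ∧ x ≤ W ∧ ¬ x ≤ H}.ncard = q ^ (r H - r y)

namespace IsQRank

open Finset
open scoped Classical

section Counting

variable {L : Type*} [Lattice L]

/-- If `H` is a hyperplane of `W`, then `x ⊓ H` is a hyperplane of every `x ≤ W` not below `H`. -/
theorem inf_covBy [IsModularLattice L] {x H W : L} (hH : H ⋖ W) (hx : x ≤ W) (hxH : ¬ x ≤ H) :
    x ⊓ H ⋖ x := by
  have h : H ⊔ x = W := by
    refine (hH.eq_or_eq le_sup_left (sup_le hH.le hx)).resolve_left fun h => hxH ?_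
    exact h ▸ le_sup_right
  rw [inf_comm]
  exact inf_covBy_of_covBy_sup_left (by rwa [h])

/-- Among the elements below `W` and not below `H`, those covering `y ≤ H` are those that meet
`H` in `y`. -/
theorem covBy_iff_inf_eq [IsModularLattice L] {x y H W : L} (hH : H ⋖ W) (hx : x ≤ W)
    (hxH : ¬ x ≤ H) (hy : y ≤ H) : y ⋖ x ↔ x ⊓ H = y := by
  constructor
  · intro h
    refine (h.eq_or_eq (le_inf h.le hy) inf_le_left).resolve_right fun h' => hxH ?_
    exact inf_eq_left.1 h'
  · rintro rfl
    exact inf_covBy hH hx hxH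

variable [BoundedOrder L] {r : L → ℕ} {q : ℕ}

theorem covBy_of_le (hr : IsQRank r q) {x y : L} (h : x ≤ y) (h' : r y = r x + 1) : x ⋖ y := by
  refine ⟨lt_of_le_of_ne h (by rintro rfl; omega), fun c h1 h2 => ?_⟩
  have := hr.strictMono h1
  have := hr.strictMono h2
  omega

theorem eq_of_le (hr : IsQRank r q) {x y : L} (h : x ≤ y) (h' : r y ≤ r x) : x = y := by
  by_contra hne
  exact (hr.strictMono (lt_of_le_of_ne h hne)).not_ge h'

theorem rank_le_top (hr : IsQRank r q) (x : L) : r x ≤ r ⊤ := hr.strictMono.monotone le_top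

theorem rank_inf [IsModularLattice L] (hr : IsQRank r q) {x H W : L} (hH : H ⋖ W) (hx : x ≤ W)
    (hxH : ¬ x ≤ H) : r x = r (x ⊓ H) + 1 :=
  hr.covBy (inf_covBy hH hx hxH)

variable [Fintype L]

theorem card_covers (hr : IsQRank r q) {y H W : L} (hy : y ≤ H) (hH : H ⋖ W) :
    #{x : L | y ⋖ x ∧ x ≤ W ∧ ¬ x ≤ H} = q ^ (r H - r y) := by
  rw [← hr.ncard_covers hy hH, Set.ncard_eq_toFinset_card', Set.toFinset_ofPred]

/-- The number of points in an interval. -/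
theorem card_covBy_le (hr : IsQRank r q) {y x : L} (h : y ≤ x) :
    #{z : L | y ⋖ z ∧ z ≤ x} = ∑ l ∈ range (r x - r y), q ^ l := by
  induction hn : r x - r y generalizing x with
  | zero =>
    obtain rfl := hr.eq_of_le h (by omega)
    rw [range_zero, sum_empty, card_eq_zero, filter_eq_empty_iff]
    exact fun z _ hz => hz.1.lt.not_ge hz.2
  | succ n ih =>
    have hlt : y < x := lt_of_le_of_ne h (by rintro rfl; omega)
    obtain ⟨H, hyH, hH⟩ := exists_le_covBy_of_lt hlt
    have h1 := hr.covBy hH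
    have h2 := hr.strictMono.monotone hyH
    rw [sum_range_succ, ← ih hyH (by omega), show n = r H - r y by omega, ← hr.card_covers hyH hH,
      ← card_union_of_disjoint]
    · congr 1
      ext z
      simp only [mem_filter, mem_univ, true_and, mem_union]
      constructor
      · rintro ⟨h3, h4⟩
        by_cases h5 : z ≤ H
        · exact Or.inl ⟨h3, h5⟩
        · exact Or.inr ⟨h3, h4, h5⟩
      · rintro (⟨h3, h4⟩ | ⟨h3, h4, -⟩)
        · exact ⟨h3, h4.trans hH.le⟩
        · exact ⟨h3, h4⟩
    · rw [disjoint_filter]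
      exact fun z _ hz hz' => hz'.2.2 hz.2

/-- The dual count: if `y` covers `x` and `y ≤ W`, then `q ^ (r W - r y)` of the elements covered
by `W` that are above `x` are not above `y`. -/
theorem card_cocovers [IsModularLattice L] (hr : IsQRank r q) {x y W : L} (hxy : x ⋖ y)
    (hy : y ≤ W) : #{H : L | H ⋖ W ∧ x ≤ H ∧ ¬ y ≤ H} = q ^ (r W - r y) := by
  induction hn : r W - r y generalizing W with
  | zero =>
    obtain rfl := hr.eq_of_le hy (by omega)
    rw [pow_zero, card_eq_one]
    refine ⟨x, ?_⟩
    ext H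
    simp only [mem_filter, mem_univ, true_and, mem_singleton]
    constructor
    · rintro ⟨h1, h2, -⟩
      exact (hxy.eq_or_eq h2 h1.le).resolve_right h1.ne
    · rintro rfl
      exact ⟨hxy, le_rfl, hxy.lt.not_ge⟩
  | succ n ih =>
    have hlt : y < W := lt_of_le_of_ne hy (by rintro rfl; omega)
    obtain ⟨W', hyW, hW⟩ := exists_le_covBy_of_lt hlt
    have h1 := hr.covBy hW
    have h2 := hr.strictMono.monotone hyW
    have hmap : ∀ H ∈ ({H : L | H ⋖ W ∧ x ≤ H ∧ ¬ y ≤ H} : Finset L),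
        H ⊓ W' ∈ ({H : L | H ⋖ W' ∧ x ≤ H ∧ ¬ y ≤ H} : Finset L) := by
      intro H hH
      simp only [mem_filter, mem_univ, true_and] at hH ⊢
      obtain ⟨h3, h4, h5⟩ := hH
      refine ⟨?_, le_inf h4 (hxy.le.trans hyW), fun h => h5 (h.trans inf_le_left)⟩
      rw [inf_comm]
      refine inf_covBy h3 hW.le fun h => h5 (hyW.trans h)
    rw [card_eq_sum_card_fiberwise hmap, pow_succ, ← ih hyW (by omega), ← smul_eq_mul,
      ← sum_const]
    refine sum_congr rfl fun H₁ hH₁ => ?_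
    simp only [mem_filter, mem_univ, true_and] at hH₁
    obtain ⟨h3, h4, h5⟩ := hH₁
    have h6 := hr.covBy h3
    have h7 := hr.card_covers h3.le hW
    rw [show r W' - r H₁ = 1 by omega, pow_one] at h7
    rw [← h7, filter_filter]
    congr 1
    ext H
    simp only [mem_filter, mem_univ, true_and]
    constructor
    · rintro ⟨⟨h8, h9, h10⟩, rfl⟩
      have h11 := hr.covBy h8
      refine ⟨hr.covBy_of_le inf_le_left (by omega), h8.le, fun h => h10 ?_⟩
      rwa [hr.eq_of_le h (by omega)]
    · rintro ⟨h8, h9, h10⟩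
      have h11 := hr.covBy h8
      have h12 : H ⊓ W' = H₁ :=
        (h8.eq_or_eq (le_inf h8.le h3.le) inf_le_left).resolve_right fun h =>
          h10 (inf_eq_left.1 h)
      exact ⟨⟨hr.covBy_of_le h9 (by omega), h4.trans h8.le,
        fun h => h5 (h12 ▸ le_inf h hyW)⟩, h12⟩

open OrderDual in
/-- The order dual has the same counts, for the corank. -/
theorem dual [IsModularLattice L] (hr : IsQRank r q) :
    IsQRank (fun x : Lᵒᵈ => r ⊤ - r (ofDual x)) q where
  strictMono x y h := by
    have h1 := hr.strictMono (ofDual_lt_ofDual.2 h)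
    have h2 := hr.rank_le_top (ofDual x)
    dsimp only
    omega
  map_bot := Nat.sub_self _
  covBy {x y} h := by
    have h1 := hr.covBy (ofDual_covBy_ofDual_iff.2 h)
    have h2 := hr.rank_le_top (ofDual x)
    omega
  ncard_covers {y H W} hy hH := by
    have h0 : ofDual W ⋖ ofDual H := ofDual_covBy_ofDual_iff.2 hH
    have h1 := hr.card_cocovers h0 (W := ofDual y) hy
    have h2 := hr.rank_le_top (ofDual y)
    have h3 := hr.strictMono.monotone (show ofDual H ≤ ofDual y from hy)
    have h4 : r ⊤ - r (ofDual H) - (r ⊤ - r (ofDual y)) = r (ofDual y) - r (ofDual H) := by omega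
    rw [h4, ← h1, ← Set.ncard_coe_finset]
    refine Set.ncard_congr (fun x _ => ofDual x) ?_ (fun _ _ _ _ h => h) ?_
    · rintro x ⟨h5, h6, h7⟩
      rw [mem_coe, mem_filter]
      exact ⟨mem_univ _, ofDual_covBy_ofDual_iff.2 h5, h6, h7⟩
    · intro x hx
      rw [mem_coe, mem_filter] at hx
      obtain ⟨-, h5, h6, h7⟩ := hx
      have h8 : y ⋖ toDual x := h5.toDual
      exact ⟨toDual x, ⟨h8, h6, h7⟩, rfl⟩

/-- The number of hyperplanes in an interval. -/
theorem card_covBy_ge [IsModularLattice L] (hr : IsQRank r q) {x W : L} (h : x ≤ W) :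
    #{H : L | H ⋖ W ∧ x ≤ H} = ∑ l ∈ range (r W - r x), q ^ l := by
  have h1 := hr.dual.card_covBy_le (y := OrderDual.toDual W) (x := OrderDual.toDual x) h
  have h2 := hr.rank_le_top W
  have h3 := hr.strictMono.monotone h
  dsimp only [OrderDual.ofDual_toDual] at h1
  rw [show r ⊤ - r x - (r ⊤ - r W) = r W - r x by omega] at h1
  rw [← h1]
  refine card_bij (fun H _ => OrderDual.toDual H) ?_ (fun _ _ _ _ h => h) ?_
  · intro H hH
    simp only [mem_filter, mem_univ, true_and] at hH ⊢
    exact ⟨toDual_covBy_toDual_iff.2 hH.1, hH.2⟩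
  · intro H hH
    simp only [mem_filter, mem_univ, true_and] at hH ⊢
    exact ⟨OrderDual.ofDual H, ⟨ofDual_covBy_ofDual_iff.2 hH.1, hH.2⟩, rfl⟩

end Counting

end IsQRank

/-! ### The inclusion map and its companions -/

namespace IsQRank

open Finset
open scoped Classical

section Operators

variable {L : Type*} [Lattice L] {F : Type*} [Field F]

/-- The functions supported on the elements below `W`. -/
def below (F : Type*) [Field F] (W : L) : Submodule F (L → F) where
  carrier := {f | ∀ x, ¬ x ≤ W → f x = 0}
  add_mem' hf hg x hx := by rw [Pi.add_apply, hf x hx, hg x hx, add_zero]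
  zero_mem' _ _ := rfl
  smul_mem' a f hf x hx := by rw [Pi.smul_apply, hf x hx, smul_zero]

/-- The functions supported on the elements of rank `k`. -/
def ofRank (F : Type*) [Field F] (r : L → ℕ) (k : ℤ) : Submodule F (L → F) where
  carrier := {f | ∀ x, (r x : ℤ) ≠ k → f x = 0}
  add_mem' hf hg x hx := by rw [Pi.add_apply, hf x hx, hg x hx, add_zero]
  zero_mem' _ _ := rfl
  smul_mem' a f hf x hx := by rw [Pi.smul_apply, hf x hx, smul_zero]

/-- For `H ⋖ W`, the pullback of a function along the projection `x ↦ x ⊓ H` of the elements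
below `W` but not below `H`. -/
noncomputable def pull (H W : L) : Module.End F (L → F) where
  toFun v x := if x ≤ W ∧ ¬ x ≤ H then v (x ⊓ H) else 0
  map_add' f g := by ext x; by_cases h : x ≤ W ∧ ¬ x ≤ H <;> simp [h]
  map_smul' a f := by ext x; by_cases h : x ≤ W ∧ ¬ x ≤ H <;> simp [h]

/-- The restriction of a function to the elements below `W`, extended by `0`. -/
noncomputable def res (W : L) : Module.End F (L → F) where
  toFun f x := if x ≤ W then f x else 0
  map_add' f g := by ext y; by_cases h : y ≤ W <;> simp [h]
  map_smul' a f := by ext y; by_cases h : y ≤ W <;> simp [h]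

/-- Multiplication of a function by the size `q ^ (r H - r z)` of the fibre of the projection
`x ↦ x ⊓ H` over `z`. Only functions supported below `H` matter, so that the subtraction is not
truncated. -/
noncomputable def fiberScale {L : Type*} (r : L → ℕ) (q : ℕ) (H : L) : Module.End F (L → F) where
  toFun v z := (q : F) ^ (r H - r z) * v z
  map_add' f g := by ext y; exact mul_add _ _ _
  map_smul' a f := by ext y; exact mul_left_comm _ _ _

theorem pull_apply (H W : L) (v : L → F) (x : L) :
    pull H W v x = if x ≤ W ∧ ¬ x ≤ H then v (x ⊓ H) else 0 := rfl

theorem res_apply (W : L) (f : L → F) (x : L) : res W f x = if x ≤ W then f x else 0 := rfl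

theorem fiberScale_apply {L : Type*} (r : L → ℕ) (q : ℕ) (H : L) (v : L → F) (z : L) :
    fiberScale r q H v z = (q : F) ^ (r H - r z) * v z := rfl

theorem below_mono {H W : L} (h : H ≤ W) : below F H ≤ below F W :=
  fun _ hf x hx => hf x fun h' => hx (h'.trans h)

theorem pull_mem_below (H W : L) (f : L → F) : pull H W f ∈ below F W :=
  fun _ hy => if_neg fun h => hy h.1

theorem res_mem_below (W : L) (f : L → F) : res W f ∈ below F W := fun _ hy => if_neg hy

theorem res_mem_ofRank {r : L → ℕ} {k : ℤ} (W : L) {f : L → F} (h : f ∈ ofRank F r k) :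
    res W f ∈ ofRank F r k := by
  intro x hx
  rw [res_apply, h x hx, ite_self]

theorem fiberScale_mem_below (r : L → ℕ) (q : ℕ) (H : L) {W : L} {f : L → F}
    (h : f ∈ below F W) : fiberScale r q H f ∈ below F W := by
  intro x hx
  rw [fiberScale_apply, h x hx, mul_zero]

theorem fiberScale_mem_ofRank {L : Type*} (r : L → ℕ) (q : ℕ) (H : L) {k : ℤ} {f : L → F}
    (h : f ∈ ofRank F r k) : fiberScale r q H f ∈ ofRank F r k := by
  intro x hx
  rw [fiberScale_apply, h x hx, mul_zero]

theorem pull_mem_ofRank [BoundedOrder L] [IsModularLattice L] {r : L → ℕ} {q : ℕ}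
    (hr : IsQRank r q) {H W : L} (hH : H ⋖ W) {k : ℤ} {f : L → F} (hf : f ∈ ofRank F r k) :
    pull H W f ∈ ofRank F r (k + 1) := by
  intro x hx
  rw [pull_apply]
  split_ifs with h
  · exact hf _ fun h' => hx (by have := hr.rank_inf hH h.1 h.2; omega)
  · rfl

variable [Fintype L]

/-- The incidence map, on functions: a basis element `x` is sent to the sum of the elements that
it covers. -/
noncomputable def down : Module.End F (L → F) where
  toFun f y := ∑ x with y ⋖ x, f x
  map_add' f g := by ext y; exact sum_add_distrib
  map_smul' a f := by ext y; exact (mul_sum _ _ _).symm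

/-- For `H ⋖ W`, the sum of a function over the fibres of the projection `x ↦ x ⊓ H` of the
elements below `W` but not below `H`. -/
noncomputable def push (H W : L) : Module.End F (L → F) where
  toFun f y := if y ≤ H then ∑ x with y ⋖ x ∧ x ≤ W ∧ ¬ x ≤ H, f x else 0
  map_add' f g := by ext y; by_cases h : y ≤ H <;> simp [h, sum_add_distrib]
  map_smul' a f := by ext y; by_cases h : y ≤ H <;> simp [h, mul_sum]

theorem down_apply (f : L → F) (y : L) : down f y = ∑ x with y ⋖ x, f x := rfl

theorem push_apply (H W : L) (f : L → F) (y : L) :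
    push H W f y = if y ≤ H then ∑ x with y ⋖ x ∧ x ≤ W ∧ ¬ x ≤ H, f x else 0 := rfl

theorem down_mem_below {W : L} {f : L → F} (hf : f ∈ below F W) : down f ∈ below F W :=
  fun _ hy => sum_eq_zero fun x hx => hf x fun h => hy ((mem_filter.1 hx).2.le.trans h)

theorem down_pow_mem_below {W : L} {f : L → F} (hf : f ∈ below F W) (i : ℕ) :
    (down ^ i) f ∈ below F W := by
  induction i with
  | zero => exact hf
  | succ i ih => rw [pow_succ', Module.End.mul_apply]; exact down_mem_below ih

theorem push_mem_below (H W : L) (f : L → F) : push H W f ∈ below F H :=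
  fun _ hy => if_neg hy

/-- A double sum as a sum over the inner variable, with multiplicities: compositions of incidence
maps are compared through numbers of chains. -/
theorem sum_filter_sum_filter {L : Type*} [Fintype L] (P : L → Prop) (Q : L → L → Prop)
    [DecidablePred P] [∀ y, DecidablePred (Q y)] [∀ x, DecidablePred fun y => P y ∧ Q y x]
    (f : L → F) :
    ∑ y with P y, ∑ x with Q y x, f x = ∑ x, (#{y | P y ∧ Q y x} : F) * f x := by
  simp_rw [sum_filter, card_filter, Nat.cast_sum, sum_mul]
  rw [sum_comm]
  refine sum_congr rfl fun y _ => ?_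
  by_cases h : P y <;> simp [h]

theorem down_push_apply (H W : L) (f : L → F) (z : L) :
    down (push H W f) z =
      ∑ x, (#{y | (z ⋖ y ∧ y ≤ H) ∧ y ⋖ x ∧ x ≤ W ∧ ¬ x ≤ H} : F) * f x := by
  refine Eq.trans ?_ (sum_filter_sum_filter (fun y => z ⋖ y ∧ y ≤ H)
    (fun y x => y ⋖ x ∧ x ≤ W ∧ ¬ x ≤ H) f)
  rw [down_apply, ← filter_filter (fun y => z ⋖ y), sum_filter (fun y => y ≤ H)]
  rfl

theorem push_down_apply {H W : L} (f : L → F) {z : L} (hz : z ≤ H) :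
    push H W (down f) z = ∑ x, (#{y | (z ⋖ y ∧ y ≤ W ∧ ¬ y ≤ H) ∧ y ⋖ x} : F) * f x := by
  refine Eq.trans ?_ (sum_filter_sum_filter (fun y => z ⋖ y ∧ y ≤ W ∧ ¬ y ≤ H)
    (fun y x => y ⋖ x) f)
  rw [push_apply, if_pos hz]
  rfl

variable [BoundedOrder L] {r : L → ℕ} {q : ℕ}

theorem down_mem_ofRank (hr : IsQRank r q) {k : ℤ} {f : L → F} (hf : f ∈ ofRank F r k) :
    down f ∈ ofRank F r (k - 1) :=
  fun y hy => sum_eq_zero fun x hx => hf x fun h => hy <| by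
    have := hr.covBy (mem_filter.1 hx).2
    omega

theorem down_pow_mem_ofRank (hr : IsQRank r q) {k : ℤ} {f : L → F} (hf : f ∈ ofRank F r k)
    (i : ℕ) : (down ^ i) f ∈ ofRank F r (k - i) := by
  induction i with
  | zero => simpa using hf
  | succ i ih =>
    rw [pow_succ', Module.End.mul_apply]
    have := hr.down_mem_ofRank ih
    rwa [sub_sub] at this

theorem push_mem_ofRank (hr : IsQRank r q) (H W : L) {k : ℤ} {f : L → F}
    (hf : f ∈ ofRank F r k) : push H W f ∈ ofRank F r (k - 1) := by
  intro y hy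
  rw [push_apply]
  split_ifs with h
  · refine sum_eq_zero fun x hx => hf x fun h => hy <| by
      have := hr.covBy (mem_filter.1 hx).2.1
      omega
  · rfl

/-- One step down in rank multiplies the size of the fibre by `q`. -/
theorem fiberScale_down (hr : IsQRank r q) {H : L} {v : L → F} (hv : v ∈ below F H) :
    fiberScale r q H (down v) = (q : F) • down (fiberScale r q H v) := by
  ext z
  rw [Pi.smul_apply, smul_eq_mul, fiberScale_apply, down_apply, down_apply, mul_sum, mul_sum]
  refine sum_congr rfl fun x hx => ?_
  rw [fiberScale_apply, ← mul_assoc, ← pow_succ']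
  by_cases hxH : x ≤ H
  · have h1 := hr.covBy (mem_filter.1 hx).2
    have h2 := hr.strictMono.monotone hxH
    rw [show r H - r z = r H - r x + 1 by omega]
  · rw [hv x hxH, mul_zero, mul_zero]

theorem fiberScale_down_pow (hr : IsQRank r q) {H : L} {v : L → F} (hv : v ∈ below F H) (i : ℕ) :
    fiberScale r q H ((down ^ i) v) = (q : F) ^ i • (down ^ i) (fiberScale r q H v) := by
  induction i with
  | zero => simp
  | succ i ih =>
    rw [pow_succ' down, Module.End.mul_apply, Module.End.mul_apply,
      hr.fiberScale_down (down_pow_mem_below hv i), ih, map_smul, smul_smul, ← pow_succ']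

variable [IsModularLattice L]

/-- Below `W` and not below `H ⋖ W`, the projection `x ↦ x ⊓ H` induces a bijection between the
covers of `z` and the covers of `z ⊓ H`; the covers of an element below `H` that are not below
`H` form a fibre of the projection. -/
theorem down_pull (hr : IsQRank r q) {H W : L} (hH : H ⋖ W) {v : L → F} (hv : v ∈ below F H) :
    down (pull H W v) = pull H W (down v) + fiberScale r q H v := by
  ext z
  rw [Pi.add_apply, down_apply, pull_apply, fiberScale_apply]
  by_cases hzW : z ≤ W
  swap
  · rw [if_neg fun h => hzW h.1, hv z fun h => hzW (h.trans hH.le), mul_zero, add_zero]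
    refine sum_eq_zero fun x hx => if_neg fun h => hzW ((mem_filter.1 hx).2.le.trans h.1)
  by_cases hzH : z ≤ H
  · rw [if_neg fun h => h.2 hzH, zero_add, ← Nat.cast_pow, ← hr.card_covers hzH hH, ← nsmul_eq_mul,
      ← sum_const]
    simp_rw [pull_apply]
    rw [← sum_filter, filter_filter]
    refine sum_congr rfl fun x hx => ?_
    rw [(covBy_iff_inf_eq hH (mem_filter.1 hx).2.2.1 (mem_filter.1 hx).2.2.2 hzH).1
      (mem_filter.1 hx).2.1]
  · rw [if_pos ⟨hzW, hzH⟩, hv z hzH, mul_zero, add_zero, down_apply]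
    simp_rw [pull_apply]
    have h1 := inf_covBy hH hzW hzH
    rw [← sum_filter, filter_filter,
      ← sum_filter_of_ne (p := fun y => y ≤ H) fun y _ => fun h => by_contra fun h' => h (hv y h'),
      filter_filter]
    refine sum_bij' (fun x _ => x ⊓ H) (fun y _ => y ⊔ z) ?_ ?_ ?_ ?_ fun _ _ => rfl
    · intro x hx
      obtain ⟨-, h2, h3, h4⟩ := mem_filter.1 hx
      have h5 := inf_covBy hH h3 h4
      have h6 := hr.covBy h1
      have h7 := hr.covBy h2
      have h8 := hr.covBy h5
      exact mem_filter.2 ⟨mem_univ _, hr.covBy_of_le (inf_le_inf_right H h2.le) (by omega),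
        inf_le_right⟩
    · intro y hy
      obtain ⟨-, h2, h3⟩ := mem_filter.1 hy
      have h4 : y ⊓ z = z ⊓ H := by
        refine (h2.eq_or_eq (le_inf h2.le inf_le_left) inf_le_left).resolve_right fun h => ?_
        exact h2.lt.not_ge (le_inf (inf_eq_left.1 h) h3)
      refine mem_filter.2 ⟨mem_univ _, covBy_sup_of_inf_covBy_left (by rwa [h4]),
        sup_le (h3.trans hH.le) hzW, fun h => hzH (le_sup_right.trans h)⟩
    · intro x hx
      obtain ⟨-, h2, h3, h4⟩ := mem_filter.1 hx
      refine (h2.eq_or_eq le_sup_right (sup_le inf_le_left h2.le)).resolve_left fun h => ?_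
      have h5 : x ⊓ H ≤ z ⊓ H := le_inf (h ▸ le_sup_left) inf_le_right
      have h6 := hr.strictMono.monotone h5
      have h7 := hr.covBy (inf_covBy hH h3 h4)
      have h8 := hr.covBy h1
      have h9 := hr.covBy h2
      omega
    · intro y hy
      obtain ⟨-, h2, h3⟩ := mem_filter.1 hy
      rw [sup_inf_assoc_of_le z h3, sup_eq_left]
      exact h2.le

/-- Iterating `down_pull`: moving `fiberScale` past `down` costs a factor `q` each time, which
produces the sum of powers of `q`. -/
theorem down_pow_pull (hr : IsQRank r q) {H W : L} (hH : H ⋖ W) {v : L → F} (hv : v ∈ below F H)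
    (i : ℕ) : (down ^ (i + 1)) (pull H W v) = pull H W ((down ^ (i + 1)) v) +
      (∑ l ∈ range (i + 1), (q : F) ^ l) • (down ^ i) (fiberScale r q H v) := by
  induction i with
  | zero => simpa using hr.down_pull hH hv
  | succ i ih =>
    rw [pow_succ' down (i + 1), Module.End.mul_apply, ih, map_add, map_smul,
      hr.down_pull hH (down_pow_mem_below hv (i + 1)), hr.fiberScale_down_pow hv,
      ← Module.End.mul_apply down, ← pow_succ' down (i + 1), ← Module.End.mul_apply down (down ^ i),
      ← pow_succ' down i, add_assoc, ← add_smul, sum_range_succ _ (i + 1), add_comm (∑ l ∈ _, _)]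

/-- Outside `H`, `pull` commutes with the powers of `down`. -/
theorem down_pow_pull_sub_mem (hr : IsQRank r q) {H W : L} (hH : H ⋖ W) {v : L → F}
    (hv : v ∈ below F H) (i : ℕ) :
    (down ^ i) (pull H W v) - pull H W ((down ^ i) v) ∈ below F H := by
  cases i with
  | zero => simp
  | succ i =>
    rw [hr.down_pow_pull hH hv, add_sub_cancel_left]
    exact Submodule.smul_mem _ _ (down_pow_mem_below (fiberScale_mem_below r q H hv) i)

/-- Chains `z ⋖ y ⋖ x`, where `z` is below a hyperplane and `x` is not: if there is one with `y`
below the hyperplane, then it is unique and there are `q` of them with `y` not below it. -/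
theorem card_chains (hr : IsQRank r q) {H W z x : L} (hH : H ⋖ W) (hz : z ≤ H) (hx : x ≤ W)
    (hxH : ¬ x ≤ H) : #{y | (z ⋖ y ∧ y ≤ W ∧ ¬ y ≤ H) ∧ y ⋖ x} =
      q * #{y | (z ⋖ y ∧ y ≤ H) ∧ y ⋖ x ∧ x ≤ W ∧ ¬ x ≤ H} := by
  have h1 := inf_covBy hH hx hxH
  have h2 := hr.covBy h1
  have key : ∀ y, y ⋖ x → y ≤ H → y = x ⊓ H := fun y h3 h4 =>
    ((h3.eq_or_eq (le_inf h3.le h4) inf_le_left).resolve_right fun h => hxH (inf_eq_left.1 h)).symm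
  by_cases hzw : z ⋖ x ⊓ H
  · have h3 : ({y | (z ⋖ y ∧ y ≤ H) ∧ y ⋖ x ∧ x ≤ W ∧ ¬ x ≤ H} : Finset L) = {x ⊓ H} := by
      ext y
      simp only [mem_filter, mem_univ, true_and, mem_singleton]
      constructor
      · rintro ⟨⟨-, h4⟩, h5, -⟩
        exact key y h5 h4
      · rintro rfl
        exact ⟨⟨hzw, inf_le_right⟩, h1, hx, hxH⟩
    have h4 := hr.card_covers hzw.le h1
    have h5 := hr.covBy hzw
    rw [show r (x ⊓ H) - r z = 1 by omega, pow_one] at h4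
    rw [h3, card_singleton, mul_one, ← h4]
    congr 1
    ext y
    simp only [mem_filter, mem_univ, true_and]
    constructor
    · rintro ⟨⟨h6, h7, h8⟩, h9⟩
      exact ⟨h6, h9.le, fun h => h8 (h.trans inf_le_right)⟩
    · rintro ⟨h6, h7, h8⟩
      have h9 := hr.covBy h6
      exact ⟨⟨h6, h7.trans hx, fun h => h8 (le_inf h7 h)⟩, hr.covBy_of_le h7 (by omega)⟩
  · rw [card_eq_zero.2, card_eq_zero.2, mul_zero]
    · rw [filter_eq_empty_iff]
      rintro y - ⟨⟨h3, h4⟩, h5, -⟩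
      exact hzw (key y h5 h4 ▸ h3)
    · rw [filter_eq_empty_iff]
      rintro y - ⟨⟨h3, h4, h5⟩, h6⟩
      have h7 := hr.covBy h3
      have h8 := hr.covBy h6
      exact hzw (hr.covBy_of_le (le_inf (h3.le.trans h6.le) hz) (by omega))

theorem push_down (hr : IsQRank r q) {H W : L} (hH : H ⋖ W) {f : L → F} (hf : f ∈ below F W) :
    push H W (down f) = (q : F) • down (push H W f) := by
  ext z
  rw [Pi.smul_apply, smul_eq_mul]
  by_cases hz : z ≤ H
  swap
  · rw [push_mem_below H W _ z hz, down_mem_below (push_mem_below H W f) z hz, mul_zero]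
  rw [push_down_apply f hz, down_push_apply, mul_sum]
  refine sum_congr rfl fun x _ => ?_
  rw [← mul_assoc]
  by_cases hx : x ≤ W
  swap
  · rw [hf x hx, mul_zero, mul_zero]
  by_cases hxH : x ≤ H
  · rw [card_eq_zero.2, card_eq_zero.2, Nat.cast_zero, mul_zero]
    · rw [filter_eq_empty_iff]
      exact fun y _ h => h.2.2.2 hxH
    · rw [filter_eq_empty_iff]
      exact fun y _ h => h.1.2.2 (h.2.le.trans hxH)
  · rw [hr.card_chains hH hz hx hxH, Nat.cast_mul]

end Operators

end IsQRank

/-! ### Projections relative to a second hyperplane -/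

namespace IsQRank

open Finset
open scoped Classical

section Exactness

variable {L : Type*} [Lattice L]

theorem not_le_of_covBy {H H' W : L} (hH : H ⋖ W) (hH' : H' ⋖ W) (hne : H' ≠ H) : ¬ H' ≤ H :=
  fun h => hne ((hH'.eq_or_eq h hH.le).resolve_right hH.ne).symm

theorem inf_covBy_right [IsModularLattice L] {H H' W : L} (hH : H ⋖ W) (hH' : H' ⋖ W)
    (hne : H' ≠ H) : H ⊓ H' ⋖ H' := by
  rw [inf_comm]
  exact inf_covBy hH hH'.le (not_le_of_covBy hH hH' hne)

variable [Fintype L] {F : Type*} [Field F]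

/-- For hyperplanes `H` and `H'` of `W`, the fibre sums over the elements below `H'`, corrected
by a multiple of the full fibre sums so that the result commutes with `down` up to the
factor `q`. -/
noncomputable def relPush (q : ℕ) (H W H' : L) : Module.End F (L → F) :=
  push (H ⊓ H') H' - (q : F)⁻¹ • res H' ∘ₗ push H W

theorem relPush_apply (q : ℕ) (H W H' : L) (f : L → F) (z : L) :
    relPush q H W H' f z = push (H ⊓ H') H' f z - (q : F)⁻¹ * res H' (push H W f) z := rfl

theorem relPush_mem_below (q : ℕ) (H W H' : L) (f : L → F) :
    relPush q H W H' f ∈ below F (H ⊓ H') := by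
  refine Submodule.sub_mem _ (push_mem_below _ _ f) (Submodule.smul_mem _ _ ?_)
  intro x hx
  rw [LinearMap.comp_apply, res_apply]
  split_ifs with h
  · exact push_mem_below H W f x fun h' => hx (le_inf h' h)
  · rfl

variable [BoundedOrder L] {r : L → ℕ} {q : ℕ}

theorem relPush_mem_ofRank (hr : IsQRank r q) (H W H' : L) {k : ℤ} {f : L → F}
    (hf : f ∈ ofRank F r k) : relPush q H W H' f ∈ ofRank F r (k - 1) :=
  Submodule.sub_mem _ (hr.push_mem_ofRank _ _ hf) (Submodule.smul_mem _ _
    (res_mem_ofRank H' (hr.push_mem_ofRank _ _ hf)))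

/-- The powers of `down` are multiples of the incidence maps between non-adjacent ranks. -/
theorem down_pow_apply (hr : IsQRank r q) (f : L → F) (j : ℕ) (y : L) :
    (down ^ j) f y = (∏ i ∈ range j, ∑ l ∈ range (i + 1), (q : F) ^ l) *
      ∑ x with y ≤ x ∧ r x = r y + j, f x := by
  induction j generalizing y with
  | zero =>
    rw [pow_zero, Module.End.one_apply, range_zero, prod_empty, one_mul]
    have h : ({x : L | y ≤ x ∧ r x = r y + 0} : Finset L) = {y} := by
      ext x
      simp only [mem_filter, mem_univ, true_and, mem_singleton]
      constructor
      · rintro ⟨h1, h2⟩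
        exact (hr.eq_of_le h1 (by omega)).symm
      · rintro rfl
        exact ⟨le_rfl, rfl⟩
    rw [h, sum_singleton]
  | succ j ih =>
    rw [pow_succ', Module.End.mul_apply, down_apply]
    simp_rw [ih]
    rw [← mul_sum, sum_filter_sum_filter (fun z => y ⋖ z) (fun z x => z ≤ x ∧ r x = r z + j) f,
      prod_range_succ, mul_assoc, mul_sum _ _ (∑ l ∈ _, _), sum_filter]
    congr 1
    refine sum_congr rfl fun x _ => ?_
    split_ifs with h
    · have h1 : #{z : L | y ⋖ z ∧ z ≤ x ∧ r x = r z + j} = #{z : L | y ⋖ z ∧ z ≤ x} := by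
        refine congrArg card (filter_congr fun z _ => and_congr_right fun h1 => and_iff_left ?_)
        rw [hr.covBy h1, h.2]
        omega
      rw [h1, hr.card_covBy_le h.1, show r x - r y = j + 1 by omega]
      push_cast
      rfl
    · rw [card_eq_zero.2, Nat.cast_zero, zero_mul]
      rw [filter_eq_empty_iff]
      rintro z - ⟨h1, h2, h3⟩
      have h4 := hr.covBy h1
      exact h ⟨h1.le.trans h2, by omega⟩

theorem down_pow_eq_zero (hr : IsQRank r q) {π : ℕ} (hπ : 0 < π)
    (h0 : ∑ l ∈ range π, (q : F) ^ l = 0) : (down ^ π : Module.End F (L → F)) = 0 := by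
  refine LinearMap.ext fun f => funext fun y => ?_
  obtain ⟨π, rfl⟩ := Nat.exists_eq_succ_of_ne_zero hπ.ne'
  rw [hr.down_pow_apply, prod_range_succ, h0, mul_zero, zero_mul]
  rfl

variable [IsModularLattice L]

/-- Let `x ≤ W` be below neither `H` nor `H'`. A chain `z ⋖ y ⋖ x` with `y` below `H'` but not
below `H` forces `y = x ⊓ H'`, and then `z ⋖ x ⊓ H ⋖ x` is such a chain for the hyperplanes
exchanged. The last two conditions in the second set hold by assumption; they are kept because
the set arises in this form. -/
theorem card_chains_swap (hr : IsQRank r q) {H H' W z x : L} (hH : H ⋖ W) (hH' : H' ⋖ W)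
    (hz : z ≤ H ⊓ H') (hx : x ≤ W) (hxH : ¬ x ≤ H) (hxH' : ¬ x ≤ H') :
    #{y : L | (z ⋖ y ∧ y ≤ H' ∧ ¬ y ≤ H ⊓ H') ∧ y ⋖ x} ≤
      #{y : L | (z ⋖ y ∧ y ≤ H ∧ ¬ y ≤ H') ∧ y ⋖ x ∧ x ≤ W ∧ ¬ x ≤ H} := by
  refine card_le_card_of_injOn (fun _ => x ⊓ H) ?_ ?_
  · intro y hy
    obtain ⟨-, ⟨h1, h2, h3⟩, h4⟩ := mem_filter.1 hy
    have h5 := hr.covBy h1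
    have h6 := hr.covBy h4
    have h7 := inf_covBy hH hx hxH
    have h8 := hr.covBy h7
    have h9 := hr.covBy (inf_covBy hH' hx hxH')
    have hzx : z ≤ x := h1.le.trans h4.le
    dsimp only
    refine mem_coe.2 (mem_filter.2 ⟨mem_univ _, ⟨hr.covBy_of_le
      (le_inf hzx (hz.trans inf_le_left)) (by omega), inf_le_right,
      fun h => h3 ?_⟩, h7, hx, hxH⟩)
    have h10 : x ⊓ H = x ⊓ H' := hr.eq_of_le (le_inf inf_le_left h) (by omega)
    have h11 : y ≤ x ⊓ H := h10 ▸ le_inf h4.le h2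
    exact le_inf (h11.trans inf_le_right) h2
  · intro y hy y' hy' _
    obtain ⟨-, ⟨-, h2, -⟩, h4⟩ := mem_filter.1 (mem_coe.1 hy)
    obtain ⟨-, ⟨-, h2', -⟩, h4'⟩ := mem_filter.1 (mem_coe.1 hy')
    have h9 := hr.covBy (inf_covBy hH' hx hxH')
    have h5 := hr.covBy h4
    have h6 := hr.covBy h4'
    rw [hr.eq_of_le (le_inf h4.le h2) (by omega), hr.eq_of_le (le_inf h4'.le h2') (by omega)]

theorem card_chains_swap_eq (hr : IsQRank r q) {H H' W z x : L} (hH : H ⋖ W) (hH' : H' ⋖ W)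
    (hz : z ≤ H ⊓ H') (hx : x ≤ W) (hxH : ¬ x ≤ H) (hxH' : ¬ x ≤ H') :
    #{y : L | (z ⋖ y ∧ y ≤ H' ∧ ¬ y ≤ H ⊓ H') ∧ y ⋖ x} =
      #{y : L | (z ⋖ y ∧ y ≤ H ∧ ¬ y ≤ H') ∧ y ⋖ x ∧ x ≤ W ∧ ¬ x ≤ H} := by
  refine le_antisymm (hr.card_chains_swap hH hH' hz hx hxH hxH') ?_
  have h := hr.card_chains_swap hH' hH (inf_comm H H' ▸ hz) hx hxH' hxH
  refine le_trans (card_le_card ?_) (h.trans (card_le_card ?_))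
  · intro y hy
    obtain ⟨-, ⟨h1, h2, h3⟩, h4, -⟩ := mem_filter.1 hy
    exact mem_filter.2 ⟨mem_univ _, ⟨h1, h2, fun h => h3 (h.trans inf_le_left)⟩, h4⟩
  · intro y hy
    obtain ⟨-, ⟨h1, h2, h3⟩, h4, -⟩ := mem_filter.1 hy
    exact mem_filter.2 ⟨mem_univ _, ⟨h1, h2, fun h => h3 (h.trans inf_le_left)⟩, h4⟩

/-- The fibre sums over the elements below `H'` fail to commute with `down` because of the
elements `x` not below `H'`; `card_chains_swap_eq` expresses their contribution through the fibre
sums over the elements below `W`. -/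
theorem push_down_of_ne (hr : IsQRank r q) {H H' W : L} (hH : H ⋖ W) (hH' : H' ⋖ W)
    (hne : H' ≠ H) {f : L → F} (hf : f ∈ below F W) {z : L} (hz : z ≤ H ⊓ H') :
    push (H ⊓ H') H' (down f) z = (q : F) * down (push (H ⊓ H') H' f) z +
      (down (push H W f) z - down (res H' (push H W f)) z) := by
  have hZ := inf_covBy_right hH hH' hne
  have h1 : down (push H W f) z - down (res H' (push H W f)) z =
      ∑ x, (#{y : L | (z ⋖ y ∧ y ≤ H ∧ ¬ y ≤ H') ∧ y ⋖ x ∧ x ≤ W ∧ ¬ x ≤ H} : F) * f x := by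
    refine Eq.trans ?_ (sum_filter_sum_filter (fun y => z ⋖ y ∧ y ≤ H ∧ ¬ y ≤ H')
      (fun y x => y ⋖ x ∧ x ≤ W ∧ ¬ x ≤ H) f)
    rw [down_apply, down_apply, ← sum_sub_distrib, ← filter_filter (fun y => z ⋖ y),
      sum_filter (fun y => y ≤ H ∧ ¬ y ≤ H')]
    refine sum_congr rfl fun y _ => ?_
    rw [res_apply, push_apply]
    by_cases h2 : y ≤ H <;> by_cases h3 : y ≤ H' <;> simp [h2, h3]
  rw [h1, push_down_apply f hz, down_push_apply, mul_sum, ← sum_add_distrib]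
  refine sum_congr rfl fun x _ => ?_
  rw [← mul_assoc, ← add_mul]
  by_cases hx : x ≤ W
  swap
  · rw [hf x hx, mul_zero, mul_zero]
  congr 1
  by_cases hxH' : x ≤ H'
  · rw [(card_eq_zero (s :=
      {y : L | (z ⋖ y ∧ y ≤ H ∧ ¬ y ≤ H') ∧ y ⋖ x ∧ x ≤ W ∧ ¬ x ≤ H})).2,
      Nat.cast_zero, add_zero]
    · by_cases hxH : x ≤ H
      · rw [card_eq_zero.2, card_eq_zero.2, Nat.cast_zero, mul_zero]
        · rw [filter_eq_empty_iff]
          exact fun y _ h => h.2.2.2 (le_inf hxH hxH')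
        · rw [filter_eq_empty_iff]
          exact fun y _ h => h.1.2.2 (le_inf (h.2.le.trans hxH) h.1.2.1)
      · rw [hr.card_chains hZ hz hxH' fun h => hxH (h.trans inf_le_left), Nat.cast_mul]
    · rw [filter_eq_empty_iff]
      exact fun y _ h => h.1.2.2 (h.2.1.le.trans hxH')
  · rw [(card_eq_zero (s :=
      {y : L | (z ⋖ y ∧ y ≤ H ⊓ H') ∧ y ⋖ x ∧ x ≤ H' ∧ ¬ x ≤ H ⊓ H'})).2,
      Nat.cast_zero, mul_zero, zero_add]
    · by_cases hxH : x ≤ H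
      · rw [card_eq_zero.2, card_eq_zero.2]
        · rw [filter_eq_empty_iff]
          exact fun y _ h => h.2.2.2 hxH
        · rw [filter_eq_empty_iff]
          exact fun y _ h => h.1.2.2 (le_inf (h.2.le.trans hxH) h.1.2.1)
      · rw [hr.card_chains_swap_eq hH hH' hz hx hxH hxH']
    · rw [filter_eq_empty_iff]
      exact fun y _ h => hxH' h.2.2.1

/-- The correction term in `relPush` cancels the defect in `push_down_of_ne`, since the full fibre
sums commute with `down` up to `q`. -/
theorem relPush_down (hr : IsQRank r q) (hq : (q : F) ≠ 0) {H H' W : L} (hH : H ⋖ W)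
    (hH' : H' ⋖ W) (hne : H' ≠ H) {f : L → F} (hf : f ∈ below F W) :
    relPush q H W H' (down f) = (q : F) • down (relPush q H W H' f) := by
  ext z
  rw [Pi.smul_apply, smul_eq_mul]
  by_cases hz : z ≤ H ⊓ H'
  swap
  · rw [relPush_mem_below q H W H' _ z hz, down_mem_below (relPush_mem_below q H W H' f) z hz,
      mul_zero]
  have h1 : down (relPush q H W H' f) z = down (push (H ⊓ H') H' f) z -
      (q : F)⁻¹ * down (res H' (push H W f)) z := by
    rw [relPush, LinearMap.sub_apply, map_sub, LinearMap.smul_apply, map_smul]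
    rfl
  rw [h1, relPush_apply, hr.push_down_of_ne hH hH' hne hf hz, hr.push_down hH hf, map_smul,
    Pi.smul_apply, smul_eq_mul, inv_mul_cancel_left₀ hq, mul_sub, mul_inv_cancel_left₀ hq,
    res_apply, if_pos (hz.trans inf_le_right)]
  ring

theorem relPush_down_pow (hr : IsQRank r q) (hq : (q : F) ≠ 0) {H H' W : L} (hH : H ⋖ W)
    (hH' : H' ⋖ W) (hne : H' ≠ H) {f : L → F} (hf : f ∈ below F W) (i : ℕ) :
    relPush q H W H' ((down ^ i) f) = (q : F) ^ i • (down ^ i) (relPush q H W H' f) := by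
  induction i with
  | zero => simp
  | succ i ih =>
    rw [pow_succ' down, Module.End.mul_apply, Module.End.mul_apply,
      hr.relPush_down hq hH hH' hne (down_pow_mem_below hf i), ih, map_smul, smul_smul,
      ← pow_succ']

/-- The number of hyperplanes of `W` above both of two elements `x` and `x'` of the same fibre.
The exponent is truncated only if `x = W`, and then `x'` must be `x`. -/
theorem card_hyperplanes (hr : IsQRank r q) {H W x x' : L} (hH : H ⋖ W) (hx : x ≤ W)
    (hxH : ¬ x ≤ H) (hx' : x ⊓ H ⋖ x' ∧ x' ≤ W ∧ ¬ x' ≤ H) :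
    (#{H' : L | (H' ⋖ W ∧ x ≤ H') ∧ x ⊓ H ⋖ x' ∧ x' ≤ H' ∧ ¬ x' ≤ H ⊓ H'} : F) =
      (∑ l ∈ range (r W - r x), (q : F) ^ l) -
        if x' = x then 0 else (q : F) ^ (r W - (r x + 1)) := by
  obtain ⟨h1, h2, h3⟩ := hx'
  have h4 : #{H' : L | (H' ⋖ W ∧ x ≤ H') ∧ x ⊓ H ⋖ x' ∧ x' ≤ H' ∧ ¬ x' ≤ H ⊓ H'} =
      #{H' : L | (H' ⋖ W ∧ x ≤ H') ∧ x' ≤ H'} := by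
    refine congrArg card (filter_congr fun H' _ => and_congr_right fun _ => ?_)
    exact ⟨fun h => h.2.1, fun h => ⟨h1, h, fun h' => h3 (h'.trans inf_le_left)⟩⟩
  have h5 : (#{H' : L | H' ⋖ W ∧ x ≤ H'} : F) = ∑ l ∈ range (r W - r x), (q : F) ^ l := by
    rw [hr.card_covBy_ge hx]
    push_cast
    rfl
  rw [h4, ← filter_filter, ← h5]
  split_ifs with h
  · subst h
    rw [sub_zero, filter_true_of_mem fun H' hH' => (mem_filter.1 hH').2.2]
  · have h6 := inf_covBy hH hx hxH
    have h7 : x ⊓ x' = x ⊓ H := by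
      refine (h6.eq_or_eq (le_inf inf_le_left h1.le) inf_le_left).resolve_right fun h7 => h ?_
      exact ((h1.eq_or_eq h6.le (inf_eq_left.1 h7)).resolve_left h6.ne').symm
    have h8 : x ⋖ x ⊔ x' := covBy_sup_of_inf_covBy_right (by rwa [h7])
    have h9 := hr.card_cocovers h8 (sup_le hx h2)
    rw [← card_filter_add_card_filter_not (s := {H' : L | H' ⋖ W ∧ x ≤ H'}) (fun H' => x' ≤ H'),
      Nat.cast_add, eq_sub_iff_add_eq, add_right_inj, ← hr.covBy h8, ← Nat.cast_pow, ← h9,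
      filter_filter]
    congr 2
    ext H'
    simp only [mem_filter, mem_univ, true_and, sup_le_iff]
    tauto

/-- The inversion formula: on the elements below `W` and not below `H`, a multiple of a function
is recovered, up to a multiple of its fibre sums, from its fibre sums relative to all the other
hyperplanes. -/
theorem sum_relPush (hr : IsQRank r q) {H W : L} (hH : H ⋖ W) (f : L → F) {x : L} (hx : x ≤ W)
    (hxH : ¬ x ≤ H) : ∑ H' with H' ⋖ W ∧ x ≤ H', relPush q H W H' f (x ⊓ H) =
      (q : F) ^ (r W - (r x + 1)) * f x +
        ((1 - (q : F)⁻¹) * (∑ l ∈ range (r W - r x), (q : F) ^ l) -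
          (q : F) ^ (r W - (r x + 1))) * push H W f (x ⊓ H) := by
  have h1 : ∑ H' with H' ⋖ W ∧ x ≤ H', push (H ⊓ H') H' f (x ⊓ H) =
      ∑ x' with x ⊓ H ⋖ x' ∧ x' ≤ W ∧ ¬ x' ≤ H, ((∑ l ∈ range (r W - r x), (q : F) ^ l) -
        if x' = x then 0 else (q : F) ^ (r W - (r x + 1))) * f x' := by
    have h2 : ∀ H' ∈ ({H' : L | H' ⋖ W ∧ x ≤ H'} : Finset L), push (H ⊓ H') H' f (x ⊓ H) =
        ∑ x' with x ⊓ H ⋖ x' ∧ x' ≤ H' ∧ ¬ x' ≤ H ⊓ H', f x' := by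
      intro H' hH'
      rw [push_apply, if_pos (le_inf inf_le_right (inf_le_left.trans (mem_filter.1 hH').2.2))]
    rw [sum_congr rfl h2, sum_filter_sum_filter (fun H' => H' ⋖ W ∧ x ≤ H')
      (fun H' x' => x ⊓ H ⋖ x' ∧ x' ≤ H' ∧ ¬ x' ≤ H ⊓ H') f,
      sum_filter (fun x' => x ⊓ H ⋖ x' ∧ x' ≤ W ∧ ¬ x' ≤ H)]
    refine sum_congr rfl fun x' _ => ?_
    split_ifs with h3 h4
    · rw [hr.card_hyperplanes hH hx hxH h3, if_pos h4]
    · rw [hr.card_hyperplanes hH hx hxH h3, if_neg h4]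
    · rw [card_eq_zero.2, Nat.cast_zero, zero_mul]
      rw [filter_eq_empty_iff]
      rintro H' - ⟨⟨h5, h6⟩, h7, h8, h9⟩
      exact h3 ⟨h7, h8.trans h5.le, fun h => h9 (le_inf h h8)⟩
  have h3 : ∑ x' with x ⊓ H ⋖ x' ∧ x' ≤ W ∧ ¬ x' ≤ H,
      (if x' = x then 0 else (q : F) ^ (r W - (r x + 1))) * f x' =
      (q : F) ^ (r W - (r x + 1)) * push H W f (x ⊓ H) - (q : F) ^ (r W - (r x + 1)) * f x := by
    rw [push_apply, if_pos inf_le_right, eq_sub_iff_add_eq, mul_sum,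
      ← add_sum_erase _ _ (mem_filter.2 ⟨mem_univ x, inf_covBy hH hx hxH, hx, hxH⟩), if_pos rfl,
      zero_mul, zero_add, add_comm,
      ← add_sum_erase _ _ (mem_filter.2 ⟨mem_univ x, inf_covBy hH hx hxH, hx, hxH⟩)]
    congr 1
    exact sum_congr rfl fun x' hx' => by rw [if_neg (mem_erase.1 hx').1]
  have h4 : ∑ H' with H' ⋖ W ∧ x ≤ H', (q : F)⁻¹ * res H' (push H W f) (x ⊓ H) =
      (∑ l ∈ range (r W - r x), (q : F) ^ l) * ((q : F)⁻¹ * push H W f (x ⊓ H)) := by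
    have h5 : ∀ H' ∈ ({H' : L | H' ⋖ W ∧ x ≤ H'} : Finset L),
        (q : F)⁻¹ * res H' (push H W f) (x ⊓ H) = (q : F)⁻¹ * push H W f (x ⊓ H) := by
      intro H' hH'
      rw [res_apply, if_pos (inf_le_left.trans (mem_filter.1 hH').2.2)]
    rw [sum_congr rfl h5, sum_const, hr.card_covBy_ge hx, nsmul_eq_mul]
    push_cast
    rfl
  simp_rw [relPush_apply, sum_sub_distrib, h4, h1, sub_mul, sum_sub_distrib, h3, ← mul_sum]
  rw [push_apply H W f (x ⊓ H), if_pos inf_le_right]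
  ring

end Exactness

end IsQRank

/-! ### Exactness away from the middle -/

namespace IsQRank

open Finset
open scoped Classical

section Exactness

variable {L : Type*} [Lattice L]

theorem exists_fiberScale_eq {F : Type*} [Field F] (r : L → ℕ) {q : ℕ} (hq : (q : F) ≠ 0)
    (H : L) {k : ℤ} {f : L → F}
    (hf : f ∈ below F H) (hf' : f ∈ ofRank F r k) :
    ∃ t ∈ below F H, t ∈ ofRank F r k ∧ fiberScale r q H t = f := by
  refine ⟨fun z => ((q : F) ^ (r H - r z))⁻¹ * f z, fun x hx => ?_, fun x hx => ?_, ?_⟩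
  · dsimp only
    rw [hf x hx, mul_zero]
  · dsimp only
    rw [hf' x hx, mul_zero]
  · ext z
    rw [fiberScale_apply, mul_inv_cancel_left₀ (pow_ne_zero _ hq)]

variable [Fintype L]

/-- Modular homology below `W` vanishes away from the middle: for `i + j = π`, a function of rank
`k` below `W` killed by `down ^ i` is in the image of `down ^ j`, unless both
`2 * k - i < r W < 2 * k + j`. -/
def ExactBelow (F : Type*) [Field F] (r : L → ℕ) (π : ℕ) (W : L) : Prop :=
  ∀ (k : ℤ) (i j : ℕ), i + j = π → ((r W : ℤ) + i ≤ 2 * k ∨ 2 * k + j ≤ r W) →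
    ∀ f ∈ below F W, f ∈ ofRank F r k → (down ^ i) f = 0 →
      ∃ g ∈ below F W, g ∈ ofRank F r (k + j) ∧ (down ^ j) g = f

variable {F : Type*} [Field F] [BoundedOrder L] {r : L → ℕ} {q π : ℕ}

variable [IsModularLattice L]

/-- The functions `u + pull v` below `W`, with `u` and `v` below a hyperplane `H`: here `down` acts
as on the tensor product of the functions below `H` with a chain of length two. Exactness in rank
`k` for the exponents `i + 1` and `j + 1` follows from exactness below `H` in rank `k` for `i + 2`
and `j`, and in rank `k - 1` for `i` and `j + 2`. -/
theorem exists_down_pow_eq_add_pull (hr : IsQRank r q) (hq : (q : F) ≠ 0)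
    (h0 : ∑ l ∈ range π, (q : F) ^ l = 0)
    (h1 : ∀ i, 0 < i → i < π → ∑ l ∈ range i, (q : F) ^ l ≠ 0) {H W : L} (hH : H ⋖ W)
    (ih : ExactBelow F r π H) {k : ℤ} {i j : ℕ} (hij : i + 1 + (j + 1) = π)
    (hk : (r W : ℤ) + (i + 1) ≤ 2 * k ∨ 2 * k + (j + 1) ≤ r W) {u v : L → F} (hu : u ∈ below F H)
    (hu' : u ∈ ofRank F r k) (hv : v ∈ below F H) (hv' : v ∈ ofRank F r (k - 1))
    (h : (down ^ (i + 1)) (u + pull H W v) = 0) :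
    ∃ g ∈ below F W, g ∈ ofRank F r (k + (j + 1)) ∧ (down ^ (j + 1)) g = u + pull H W v := by
  have hrW := hr.covBy hH
  set a : F := ∑ l ∈ range (i + 1), (q : F) ^ l with ha
  set b : F := ∑ l ∈ range (j + 1), (q : F) ^ l with hb
  have ha0 : a ≠ 0 := h1 _ (by omega) (by omega)
  -- The `q`-integer of `π = (i + 1) + (j + 1)` vanishes.
  have hab : b = -((q : F) ^ (j + 1) * a) := by
    rw [eq_neg_iff_add_eq_zero, ← h0, ← hij, add_comm (i + 1), sum_range_add, mul_sum]
    simp_rw [pow_add]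
    rfl
  rw [map_add, hr.down_pow_pull hH hv, ← ha, add_left_comm] at h
  -- The two components, on the elements below `H` and on the others.
  have hlow : (down ^ (i + 1)) u + a • (down ^ i) (fiberScale r q H v) = 0 := by
    ext x
    by_cases hx : x ≤ H
    · have := congrFun h x
      rwa [Pi.add_apply, pull_apply, if_neg fun h => h.2 hx, zero_add] at this
    · exact Submodule.add_mem _ (down_pow_mem_below hu _)
        (Submodule.smul_mem _ a (down_pow_mem_below (fiberScale_mem_below r q H hv) i)) x hx
  have hhigh : (down ^ (i + 1)) v = 0 := by
    rw [hlow, add_zero] at h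
    ext y
    by_cases hy : y ≤ H
    · have hne : (({x | y ⋖ x ∧ x ≤ W ∧ ¬ x ≤ H} : Finset L)).Nonempty := by
        rw [← card_pos, hr.card_covers hy hH]
        refine Nat.pos_of_ne_zero fun h => pow_ne_zero (r H - r y) hq ?_
        rw [← Nat.cast_pow, h, Nat.cast_zero]
      obtain ⟨x, hx⟩ := hne
      obtain ⟨-, h2, h3, h4⟩ := mem_filter.1 hx
      have := congrFun h x
      rwa [pull_apply, if_pos ⟨h3, h4⟩, (covBy_iff_inf_eq hH h3 h4 hy).1 h2] at this
    · exact down_pow_mem_below hv _ y hy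
  -- `hlow` and `hhigh` give `down ^ (i + 2) u = 0`, so `u = down ^ j w`; and `hlow` gives
  -- `down u + a • fiberScale v = down ^ (j + 2) z`.
  obtain ⟨w, hw, hw', hwu⟩ := ih k (i + 2) j (by omega) (by push_cast; omega) u hu hu' (by
    rw [pow_succ', Module.End.mul_apply, eq_neg_of_add_eq_zero_left hlow, map_neg, map_smul,
      ← Module.End.mul_apply, ← pow_succ', ← smul_right_injective _ (pow_ne_zero (i + 1) hq) |>.eq_iff,
      smul_zero, smul_neg, smul_comm, ← hr.fiberScale_down_pow hv, hhigh, map_zero, smul_zero,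
      neg_zero])
  obtain ⟨z, hz, hz', hzu⟩ := ih (k - 1) i (j + 2) (by omega) (by push_cast; omega)
    (down u + a • fiberScale r q H v)
    (Submodule.add_mem _ (down_mem_below hu) (Submodule.smul_mem _ _ (fiberScale_mem_below _ _ _ hv)))
    (Submodule.add_mem _ (hr.down_mem_ofRank hu')
      (Submodule.smul_mem _ _ (fiberScale_mem_ofRank _ _ _ hv')))
    (by rw [map_add, map_smul, ← Module.End.mul_apply, ← pow_succ, hlow])
  have hk' : k - 1 + ((j + 2 : ℕ) : ℤ) = k + (j + 1) := by push_cast; ring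
  rw [hk'] at hz'
  have hz1 := hr.down_mem_ofRank hz'
  rw [show k + ((j : ℤ) + 1) - 1 = k + j by ring] at hz1
  -- The preimage is `z + pull t`, where `t` is chosen with `down ^ (j + 1) t = v` and
  -- `down ^ (j + 1) z + b • down ^ j (fiberScale t) = down ^ j w = u`.
  obtain ⟨t, ht, ht', htz⟩ := exists_fiberScale_eq r hq H
    (Submodule.smul_mem _ (a⁻¹ * ((q : F) ^ (j + 1))⁻¹) (Submodule.sub_mem _ (down_mem_below hz) hw))
    (Submodule.smul_mem _ (a⁻¹ * ((q : F) ^ (j + 1))⁻¹) (Submodule.sub_mem _ hz1 hw'))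
  have htv : (down ^ (j + 1)) t = v := by
    have h2 : fiberScale r q H ((down ^ (j + 1)) t) = fiberScale r q H v := by
      rw [hr.fiberScale_down_pow ht, htz, map_smul, smul_smul, mul_left_comm,
        mul_inv_cancel₀ (pow_ne_zero _ hq), mul_one, map_sub, ← Module.End.mul_apply, ← pow_succ,
        hzu, pow_succ' down j, Module.End.mul_apply, hwu, add_sub_cancel_left, smul_smul,
        inv_mul_cancel₀ ha0, one_smul]
    ext y
    have h3 := congrFun h2 y
    rw [fiberScale_apply, fiberScale_apply] at h3
    exact mul_left_cancel₀ (pow_ne_zero _ hq) h3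
  refine ⟨z + pull H W t, Submodule.add_mem _ (below_mono hH.le hz) (pull_mem_below _ _ _),
    Submodule.add_mem _ hz' ?_, ?_⟩
  · have := hr.pull_mem_ofRank hH ht'
    rwa [add_assoc] at this
  · rw [map_add, hr.down_pow_pull hH ht, htv, htz, ← hb, hab, map_smul, map_sub, smul_smul,
      show -((q : F) ^ (j + 1) * a) * (a⁻¹ * ((q : F) ^ (j + 1))⁻¹) = -1 by
        field_simp, hwu, pow_succ, Module.End.mul_apply, neg_one_smul]
    abel

/-- Up to a nonzero factor and up to the image of a power of `down`, a function killed by a power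
of `down` comes from a hyperplane: the remaining part is treated with the fibre sums relative to
the other hyperplanes, that is, with exactness in corank two. -/
theorem exists_smul_sub_down_pow_eq (hr : IsQRank r q) (hq : (q : F) ≠ 0) {H W : L} (hH : H ⋖ W)
    (ih : ∀ Z, r Z + 2 = r W → ExactBelow F r π Z) {k : ℤ} {i j : ℕ} (hij : i + j = π)
    (hk : (r W : ℤ) + i ≤ 2 * k ∨ 2 * k + j ≤ r W) {f : L → F} (hf : f ∈ below F W)
    (hf' : f ∈ ofRank F r k) (h : (down ^ i) f = 0) :
    ∃ c : F, c ≠ 0 ∧ ∃ g ∈ below F W, g ∈ ofRank F r (k + j) ∧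
      ∃ u ∈ below F H, u ∈ ofRank F r k ∧ ∃ v ∈ below F H, v ∈ ofRank F r (k - 1) ∧
        c • f - (down ^ j) g = u + pull H W v := by
  have key : ∀ H', ∃ g : L → F, H' ⋖ W → H' ≠ H → g ∈ below F (H ⊓ H') ∧
      g ∈ ofRank F r (k - 1 + j) ∧ (down ^ j) g = relPush q H W H' f := by
    intro H'
    by_cases hH' : H' ⋖ W
    swap
    · exact ⟨0, fun h => absurd h hH'⟩
    by_cases hne : H' = H
    · exact ⟨0, fun _ h => absurd hne h⟩
    have h1 := hr.covBy hH'
    have h2 := hr.covBy (inf_covBy_right hH hH' hne)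
    obtain ⟨g, h3, h4, h5⟩ := ih (H ⊓ H') (by omega) (k - 1) i j hij (by omega)
      (relPush q H W H' f) (relPush_mem_below _ _ _ _ _) (hr.relPush_mem_ofRank _ _ _ hf') (by
        rw [← smul_right_injective _ (pow_ne_zero i hq) |>.eq_iff, smul_zero,
          ← hr.relPush_down_pow hq hH hH' hne hf, h, map_zero])
    exact ⟨g, fun _ _ => ⟨h3, h4, h5⟩⟩
  choose G hG using key
  set g : L → F := ∑ H' with H' ⋖ W ∧ H' ≠ H, pull (H ⊓ H') H' (G H') with hg
  have hgW : g ∈ below F W := Submodule.sum_mem _ fun H' hH' =>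
    below_mono (mem_filter.1 hH').2.1.le (pull_mem_below _ _ _)
  have hgk : g ∈ ofRank F r (k + j) := Submodule.sum_mem _ fun H' hH' => by
    obtain ⟨-, h1, h2⟩ := mem_filter.1 hH'
    have h3 := hr.pull_mem_ofRank (inf_covBy_right hH h1 h2) (hG H' h1 h2).2.1
    rwa [show k - 1 + (j : ℤ) + 1 = k + j by ring] at h3
  -- The coefficients in `sum_relPush` at the elements of rank `k`, the only ones that matter.
  set κ : F := (q : F) ^ (r W - (k.toNat + 1)) with hκ
  set μ : F := κ - (1 - (q : F)⁻¹) * ∑ l ∈ range (r W - k.toNat), (q : F) ^ l with hμ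
  have hu : κ • f - (down ^ j) g ∈ ofRank F r k := by
    have h1 := hr.down_pow_mem_ofRank hgk j
    rw [add_sub_cancel_right] at h1
    exact Submodule.sub_mem _ (Submodule.smul_mem _ _ hf') h1
  have huW : κ • f - (down ^ j) g ∈ below F W :=
    Submodule.sub_mem _ (Submodule.smul_mem _ _ hf) (down_pow_mem_below hgW j)
  have hvk : μ • push H W f ∈ ofRank F r (k - 1) :=
    Submodule.smul_mem _ _ (hr.push_mem_ofRank _ _ hf')
  refine ⟨κ, pow_ne_zero _ hq, g, hgW, hgk, res H (κ • f - (down ^ j) g), res_mem_below _ _,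
    res_mem_ofRank H hu, μ • push H W f, Submodule.smul_mem _ _ (push_mem_below _ _ _), hvk, ?_⟩
  ext x
  rw [Pi.add_apply, res_apply, pull_apply]
  by_cases hxW : x ≤ W
  swap
  · rw [huW x hxW, ite_self, if_neg fun h => hxW h.1, add_zero]
  by_cases hxH : x ≤ H
  · rw [if_pos hxH, if_neg fun h => h.2 hxH, add_zero]
  rw [if_neg hxH, if_pos ⟨hxW, hxH⟩, zero_add]
  by_cases hxk : (r x : ℤ) = k
  swap
  · rw [hu x hxk, hvk]
    intro h1
    have h2 := hr.rank_inf hH hxW hxH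
    omega
  have h1 : (down ^ j) g x =
      ∑ H' with H' ⋖ W ∧ x ≤ H', relPush q H W H' f (x ⊓ H) := by
    rw [hg, map_sum, Finset.sum_apply, sum_filter, sum_filter]
    refine sum_congr rfl fun H' _ => ?_
    by_cases hH' : H' ⋖ W
    swap
    · rw [if_neg fun h => hH' h.1, if_neg fun h => hH' h.1]
    by_cases hne : H' = H
    · rw [if_neg fun h => h.2 hne, if_neg fun h => hxH (hne ▸ h.2)]
    obtain ⟨h2, -, h3⟩ := hG H' hH' hne
    have h4 : (down ^ j) (pull (H ⊓ H') H' (G H')) x =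
        pull (H ⊓ H') H' (relPush q H W H' f) x := by
      rw [← h3, ← sub_eq_zero, ← Pi.sub_apply]
      exact hr.down_pow_pull_sub_mem (inf_covBy_right hH hH' hne) h2 j x
        fun h => hxH (h.trans inf_le_left)
    rw [if_pos ⟨hH', hne⟩, h4, pull_apply]
    by_cases hxH' : x ≤ H'
    · rw [if_pos ⟨hxH', fun h => hxH (h.trans inf_le_left)⟩, if_pos ⟨hH', hxH'⟩,
        inf_comm H H', ← inf_assoc, inf_eq_left.2 hxH']
    · rw [if_neg fun h => hxH' h.1, if_neg fun h => hxH' h.2]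
  rw [Pi.sub_apply, h1, hr.sum_relPush hH f hxW hxH, Pi.smul_apply, Pi.smul_apply, smul_eq_mul,
    smul_eq_mul, hμ, hκ, show k.toNat = r x by omega]
  ring

/-- Exactness below every element, by induction on the rank. -/
theorem exactBelow (hr : IsQRank r q) (hq : (q : F) ≠ 0)
    (h0 : ∑ l ∈ range π, (q : F) ^ l = 0)
    (h1 : ∀ i, 0 < i → i < π → ∑ l ∈ range i, (q : F) ^ l ≠ 0) (W : L) : ExactBelow F r π W := by
  induction hn : r W using Nat.strong_induction_on generalizing W with
  | _ n ih =>
    subst hn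
    intro k i j hij hk f hf hf' h
    rcases i with _ | i
    · exact ⟨0, Submodule.zero_mem _, Submodule.zero_mem _, by rw [map_zero]; exact h.symm⟩
    rcases j with _ | j
    · exact ⟨f, hf, by simpa using hf', rfl⟩
    by_cases hW : W = ⊥
    · have hrW : r W = 0 := hW ▸ hr.map_bot
      have hf0 : f = 0 := by
        ext x
        by_cases hx : x ≤ W
        · refine hf' x ?_
          rw [show x = W from le_antisymm hx (hW ▸ bot_le), hrW]
          rw [hrW] at hk
          push_cast at hk
          omega
        · exact hf x hx
      exact ⟨0, Submodule.zero_mem _, Submodule.zero_mem _, by rw [map_zero, hf0]⟩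
    obtain ⟨H, -, hH⟩ := exists_le_covBy_of_lt (bot_lt_iff_ne_bot.2 hW)
    have hrW := hr.covBy hH
    obtain ⟨c, hc, g, hg, hg', u, hu, hu', v, hv, hv', huv⟩ :=
      hr.exists_smul_sub_down_pow_eq hq hH (fun Z hZ => ih _ (by omega) Z rfl) hij hk hf hf' h
    obtain ⟨g', h2, h3, h4⟩ := hr.exists_down_pow_eq_add_pull hq h0 h1 hH (ih _ (by omega) H rfl)
      hij (by push_cast at hk; exact hk) hu hu' hv hv' (by
        rw [← huv, map_sub, map_smul, h, smul_zero, ← Module.End.mul_apply, ← pow_add, hij,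
          hr.down_pow_eq_zero (by omega) h0, LinearMap.zero_apply, sub_zero])
    push_cast at hg' ⊢
    refine ⟨c⁻¹ • (g + g'), Submodule.smul_mem _ _ (Submodule.add_mem _ hg h2),
      Submodule.smul_mem _ _ (Submodule.add_mem _ hg' h3), ?_⟩
    rw [map_smul, map_add, h4, ← huv, add_sub_cancel, smul_smul, inv_mul_cancel₀ hc, one_smul]

end Exactness

end IsQRank

/-! ### Complements -/

namespace IsQRank

open Finset
open scoped Classical

section Complements

variable {L : Type*} [Lattice L] [BoundedOrder L] [Fintype L] [IsModularLattice L] {r : L → ℕ}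
  {q : ℕ} {F : Type*} [Field F]

/-- The values of the Möbius function of the lattice on the intervals `[⊥, z]`. -/
theorem sum_moebius (hr : IsQRank r q) (W : L) :
    ∑ z with z ≤ W, (-1 : F) ^ r z * (q : F) ^ (r z).choose 2 = if W = ⊥ then 1 else 0 := by
  induction hn : r W generalizing W with
  | zero =>
    obtain rfl := (hr.eq_of_le (bot_le (a := W)) (by omega)).symm
    have h : ({z : L | z ≤ ⊥} : Finset L) = {⊥} := by
      ext z
      simp
    rw [if_pos rfl, h, sum_singleton, hr.map_bot]
    simp
  | succ n ih =>
    have hW : ⊥ < W := bot_lt_iff_ne_bot.2 fun h => by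
      rw [h, hr.map_bot] at hn
      omega
    obtain ⟨H, -, hH⟩ := exists_le_covBy_of_lt hW
    have hrW := hr.covBy hH
    have h1 : ∑ z with z ≤ W, (-1 : F) ^ r z * (q : F) ^ (r z).choose 2 =
        ∑ z with z ≤ H, (-1 : F) ^ r z * (q : F) ^ (r z).choose 2 +
        ∑ z with z ≤ W ∧ ¬ z ≤ H, (-1 : F) ^ r z * (q : F) ^ (r z).choose 2 := by
      rw [← sum_filter_add_sum_filter_not ({z : L | z ≤ W} : Finset L) (fun z => z ≤ H),
        filter_filter, filter_filter]
      congr 2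
      ext z
      simp only [mem_filter, mem_univ, true_and, and_iff_right_iff_imp]
      exact fun h => h.trans hH.le
    have h2 : ∑ z with z ≤ W ∧ ¬ z ≤ H, (-1 : F) ^ r z * (q : F) ^ (r z).choose 2 =
        -(q : F) ^ r H * ∑ y with y ≤ H, (-1 : F) ^ r y * (q : F) ^ (r y).choose 2 := by
      rw [← sum_fiberwise_of_maps_to (t := ({y : L | y ≤ H} : Finset L)) (g := fun z => z ⊓ H)
        (fun z _ => mem_filter.2 ⟨mem_univ _, inf_le_right⟩), mul_sum]
      refine sum_congr rfl fun y hy => ?_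
      have hy' := (mem_filter.1 hy).2
      have h3 : ∀ z ∈ ({z : L | z ≤ W ∧ ¬ z ≤ H} : Finset L).filter (fun z => z ⊓ H = y),
          (-1 : F) ^ r z * (q : F) ^ (r z).choose 2 =
            (-1 : F) ^ (r y + 1) * (q : F) ^ (r y + 1).choose 2 := by
        intro z hz
        have hzW := (mem_filter.1 (mem_filter.1 hz).1).2
        rw [hr.rank_inf hH hzW.1 hzW.2, (mem_filter.1 hz).2]
      have h4 : #(({z : L | z ≤ W ∧ ¬ z ≤ H} : Finset L).filter (fun z => z ⊓ H = y)) =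
          q ^ (r H - r y) := by
        rw [← hr.card_covers hy' hH, filter_filter]
        refine congrArg card (filter_congr fun z _ => ?_)
        constructor
        · rintro ⟨⟨h4, h5⟩, h6⟩
          exact ⟨(covBy_iff_inf_eq hH h4 h5 hy').2 h6, h4, h5⟩
        · rintro ⟨h4, h5, h6⟩
          exact ⟨⟨h5, h6⟩, (covBy_iff_inf_eq hH h5 h6 hy').1 h4⟩
      have h5 : (q : F) ^ r H = (q : F) ^ (r H - r y) * (q : F) ^ r y := by
        rw [← pow_add, Nat.sub_add_cancel (hr.strictMono.monotone hy')]
      rw [sum_congr rfl h3, sum_const, h4, nsmul_eq_mul, h5, Nat.choose_succ_succ' (r y) 1,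
        Nat.choose_one_right]
      push_cast
      ring
    rw [h1, h2, ih H (by omega), if_neg hW.ne']
    split_ifs with h
    · rw [h, hr.map_bot]
      ring
    · ring

/-- The relation `x ⊓ y = ⊥` has an invertible matrix: it is `ζᵀ * D * ζ` for the zeta matrix `ζ`
and the diagonal matrix `D` of the Möbius values, none of which vanishes. -/
theorem eq_zero_of_sum_inf_eq_bot (hr : IsQRank r q) (hq : (q : F) ≠ 0) {f : L → F}
    (h : ∀ y, ∑ x with x ⊓ y = ⊥, f x = 0) : f = 0 := by
  have h1 : ∀ y, ∑ z with z ≤ y, ((-1 : F) ^ r z * (q : F) ^ (r z).choose 2) *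
      ∑ x with z ≤ x, f x = 0 := by
    intro y
    rw [← h y]
    simp_rw [mul_sum]
    rw [sum_comm' (t' := univ) (s' := fun x => ({z : L | z ≤ x ⊓ y} : Finset L)) fun z x => by
      simp only [mem_filter, mem_univ, true_and, and_true, le_inf_iff]
      exact and_comm]
    simp_rw [← sum_mul, hr.sum_moebius, ite_mul, one_mul, zero_mul]
    rw [sum_filter]
  have h2 : ∀ y, ∑ x with y ≤ x, f x = 0 := by
    intro y
    induction y using WellFoundedLT.induction with
    | _ y ih =>
      have h3 := h1 y
      have hy : y ∈ ({z : L | z ≤ y} : Finset L) := by simp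
      rw [sum_eq_single_of_mem y hy fun z hz hzy => by
        rw [ih z (lt_of_le_of_ne (mem_filter.1 hz).2 hzy), mul_zero]] at h3
      refine (mul_eq_zero.1 h3).resolve_left (mul_ne_zero ?_ (pow_ne_zero _ hq))
      exact pow_ne_zero _ (neg_ne_zero.2 one_ne_zero)
  ext y
  induction y using WellFoundedGT.induction with
  | _ y ih =>
    have h3 := h2 y
    rwa [sum_eq_single_of_mem y (mem_filter.2 ⟨mem_univ _, le_rfl⟩) fun z hz hzy =>
      ih z (lt_of_le_of_ne (mem_filter.1 hz).2 hzy.symm)] at h3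

theorem eq_zero_of_sum_sup_eq_top (hr : IsQRank r q) (hq : (q : F) ≠ 0) {f : L → F}
    (h : ∀ y, ∑ x with x ⊔ y = ⊤, f x = 0) : f = 0 :=
  hr.dual.eq_zero_of_sum_inf_eq_bot (F := F) (f := f) hq h

theorem rank_add_rank_le_of_inf_eq_bot (hr : IsQRank r q) {x y : L} (h : x ⊓ y = ⊥) :
    r x + r y ≤ r ⊤ := by
  suffices r x + r y ≤ r (x ⊔ y) from this.trans (hr.rank_le_top _)
  induction hn : r x generalizing x with
  | zero => rw [zero_add]; exact hr.strictMono.monotone le_sup_right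
  | succ n ih =>
    have hx : ⊥ < x := bot_lt_iff_ne_bot.2 fun h => by
      rw [h, hr.map_bot] at hn
      omega
    obtain ⟨z, -, hz⟩ := exists_le_covBy_of_lt hx
    have h1 := hr.covBy hz
    have h2 : z ⊓ y = ⊥ := le_bot_iff.1 (h ▸ inf_le_inf_right y hz.le)
    have h3 := hr.strictMono (sup_lt_sup_of_lt_of_inf_le_inf (z := y) hz.lt (by rw [h, h2]))
    have h4 := ih h2 (by omega)
    omega

theorem le_rank_add_rank_of_sup_eq_top (hr : IsQRank r q) {x y : L} (h : x ⊔ y = ⊤) :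
    r ⊤ ≤ r x + r y := by
  have h1 := hr.dual.rank_add_rank_le_of_inf_eq_bot (x := OrderDual.toDual x)
    (y := OrderDual.toDual y) h
  dsimp only [OrderDual.ofDual_toDual, OrderDual.ofDual_top] at h1
  have h2 := hr.rank_le_top x
  have h3 := hr.rank_le_top y
  omega

end Complements

end IsQRank

/-! ### Permutation modules on sets of ranks -/

section PermutationModules

variable {L : Type*} [Lattice L] (F : Type*) [Field F] (G : Subgroup (L ≃o L))

/-- The functions on `L` that vanish outside `X`. -/
def functionsOn (X : SubMulAction (L ≃o L) L) : Submodule F (L → F) where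
  carrier := {f | ∀ x, x ∉ X → f x = 0}
  add_mem' hf hg x hx := by rw [Pi.add_apply, hf x hx, hg x hx, add_zero]
  zero_mem' _ _ := rfl
  smul_mem' a f hf x hx := by rw [Pi.smul_apply, hf x hx, smul_zero]

open Classical in
/-- The permutation module on `X` as the space of functions on `L` that vanish outside `X`. -/
noncomputable def permModuleEquiv [Finite L] (X : SubMulAction (L ≃o L) L) :
    PermModule F G X ≃ₗ[F] functionsOn F X where
  toFun v := ⟨fun x => if h : x ∈ X then
    ((Representation.ofMulAction F G X).asModuleEquiv v).coeff ⟨x, h⟩ else 0,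
    fun x hx => dif_neg hx⟩
  map_add' v w := by
    ext x
    by_cases h : x ∈ X <;> simp [h]
  map_smul' a v := by
    ext x
    by_cases h : x ∈ X <;> simp [h]
  invFun f := (Representation.ofMulAction F G X).asModuleEquiv.symm
    (MonoidAlgebra.ofCoeff (Finsupp.equivFunOnFinite.symm fun x => (f : L → F) x))
  left_inv v := by
    refine (Representation.ofMulAction F G X).asModuleEquiv.injective
      (MonoidAlgebra.coeff_injective ?_)
    ext x
    simp
  right_inv f := by
    ext x
    by_cases h : x ∈ X
    · simp [h]
    · simp [h, f.2 x h]

/-- A group element acts on functions by `f ↦ f ∘ g⁻¹`. -/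
theorem permModuleEquiv_single_smul [Finite L] (X : SubMulAction (L ≃o L) L) (g : G)
    (v : PermModule F G X) (x : L) :
    (permModuleEquiv F G X (MonoidAlgebra.single g (1 : F) • v) : L → F) ((g : L ≃o L) x) =
      (permModuleEquiv F G X v : L → F) x := by
  classical
  rw [Representation.single_smul, one_smul]
  by_cases h : x ∈ X
  · have h' : (g : L ≃o L) x ∈ X := X.smul_mem g h
    change dite _ _ _ = dite _ _ _
    rw [dif_pos h, dif_pos h']
    exact Finsupp.mapDomain_apply (MulAction.injective g) _ (⟨x, h⟩ : X)
  · have h' : (g : L ≃o L) x ∉ X := fun h' => h (by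
      have := X.smul_mem (g : L ≃o L)⁻¹ h'
      rwa [show (g : L ≃o L)⁻¹ • (g : L ≃o L) x = x from (g : L ≃o L).symm_apply_apply x] at this)
    exact ((permModuleEquiv F G X _).2 _ h').trans ((permModuleEquiv F G X _).2 _ h).symm

variable {F G}

/-- A linear map between spaces of functions on `L` that commutes with the order automorphisms is
a homomorphism of permutation modules. -/
noncomputable def permModuleMap [Finite L] {X Y : SubMulAction (L ≃o L) L}
    (T : Module.End F (L → F)) (hT : ∀ (g : L ≃o L) f, T (f ∘ g) = T f ∘ g)
    (hXY : ∀ f ∈ functionsOn F X, T f ∈ functionsOn F Y) :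
    PermModule F G X →ₗ[MonoidAlgebra F G] PermModule F G Y :=
  MonoidAlgebra.equivariantOfLinearOfComm
    ((permModuleEquiv F G Y).symm.toLinearMap ∘ₗ T.restrict hXY ∘ₗ
      (permModuleEquiv F G X).toLinearMap) (by
    intro g v
    refine (permModuleEquiv F G Y).injective (Subtype.ext (funext fun x => ?_))
    have h : ∀ w : PermModule F G X, (permModuleEquiv F G X w : L → F) =
        (permModuleEquiv F G X (MonoidAlgebra.single g (1 : F) • w) : L → F) ∘ (g : L ≃o L) :=
      fun w => funext fun x => (permModuleEquiv_single_smul F G X g w x).symm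
    obtain ⟨x, rfl⟩ := (g : L ≃o L).surjective x
    rw [permModuleEquiv_single_smul]
    simp only [LinearMap.comp_apply, LinearEquiv.coe_coe, LinearEquiv.apply_symm_apply,
      LinearMap.coe_restrict_apply]
    rw [h v, hT, Function.comp_apply])

theorem permModuleEquiv_permModuleMap [Finite L] {X Y : SubMulAction (L ≃o L) L}
    (T : Module.End F (L → F)) (hT : ∀ (g : L ≃o L) f, T (f ∘ g) = T f ∘ g)
    (hXY : ∀ f ∈ functionsOn F X, T f ∈ functionsOn F Y) (v : PermModule F G X) :
    (permModuleEquiv F G Y (permModuleMap T hT hXY v) : L → F) = T (permModuleEquiv F G X v) := by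
  simp [permModuleMap]

instance [Finite L] (X : SubMulAction (L ≃o L) L) :
    IsNoetherian (MonoidAlgebra F G) (PermModule F G X) :=
  have : Module.Finite F (PermModule F G X) := Module.Finite.equiv (permModuleEquiv F G X).symm
  isNoetherian_of_tower F inferInstance

instance [Finite L] (X : SubMulAction (L ≃o L) L) :
    IsArtinian (MonoidAlgebra F G) (PermModule F G X) :=
  have : Module.Finite F (PermModule F G X) := Module.Finite.equiv (permModuleEquiv F G X).symm
  isArtinian_of_tower F inferInstance

end PermutationModules

/-! ### Multiplicities in rank layers -/

section Layers

variable {L : Type*} [Lattice L] {r : L → ℕ}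

/-- The elements whose rank lies in `A`. -/
def rankSet (hG : ∀ (g : L ≃o L) x, r (g x) = r x) (A : Set ℤ) : SubMulAction (L ≃o L) L where
  carrier := {x | (r x : ℤ) ∈ A}
  smul_mem' g x hx := by
    have h : ((r (g x) : ℕ) : ℤ) ∈ A := (hG g x).symm ▸ hx
    exact h

variable (F : Type*) [Field F] (G : Subgroup (L ≃o L)) (U : Type*) [AddCommGroup U]
  [Module (MonoidAlgebra F G) U]

/-- The multiplicity of `U` in the permutation module on the elements whose rank lies in `A`. -/
noncomputable def rankMult (hG : ∀ (g : L ≃o L) x, r (g x) = r x) (A : Set ℤ) : ℕ :=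
  multiplicityIn (MonoidAlgebra F G) (PermModule F G (rankSet hG A)) U

variable {F G}

theorem permModuleMap_injective [Finite L] {X Y : SubMulAction (L ≃o L) L}
    (T : Module.End F (L → F)) (hT : ∀ (g : L ≃o L) f, T (f ∘ g) = T f ∘ g)
    (hXY : ∀ f ∈ functionsOn F X, T f ∈ functionsOn F Y)
    (hinj : ∀ f ∈ functionsOn F X, T f = 0 → f = 0) :
    Function.Injective (permModuleMap (G := G) T hT hXY) := by
  rw [injective_iff_map_eq_zero]
  intro v hv
  refine (permModuleEquiv F G X).map_eq_zero_iff.1 (Subtype.ext ?_)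
  refine hinj _ (permModuleEquiv F G X v).2 ?_
  rw [← permModuleEquiv_permModuleMap T hT hXY, hv, map_zero]
  rfl

variable [Finite L] (hG : ∀ (g : L ≃o L) x, r (g x) = r x)

theorem rankMult_le (A B : Set ℤ) (T : Module.End F (L → F))
    (hT : ∀ (g : L ≃o L) f, T (f ∘ g) = T f ∘ g) (hinj : ∀ f, T f = 0 → f = 0)
    (hAB : ∀ f : L → F, (∀ x, (r x : ℤ) ∉ A → f x = 0) → ∀ y, (r y : ℤ) ∉ B → T f y = 0) :
    rankMult F G U hG A ≤ rankMult F G U hG B :=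
  multiplicityIn_le_of_injective U (permModuleMap (X := rankSet hG A) (Y := rankSet hG B) T hT hAB)
    (permModuleMap_injective (X := rankSet hG A) (Y := rankSet hG B) T hT hAB fun f _ => hinj f)

open Classical in
/-- The permutation module on a disjoint union is the direct sum of the two permutation modules. -/
theorem rankMult_union {A B : Set ℤ} (hAB : Disjoint A B) :
    rankMult F G U hG (A ∪ B) = rankMult F G U hG A + rankMult F G U hG B := by
  let T : Module.End F (L → F) :=
    { toFun := fun f x => if (r x : ℤ) ∈ B then f x else 0
      map_add' := fun f g => by ext x; by_cases h : (r x : ℤ) ∈ B <;> simp [h]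
      map_smul' := fun a f => by ext x; by_cases h : (r x : ℤ) ∈ B <;> simp [h] }
  have hT : ∀ (g : L ≃o L) f, T (f ∘ g) = T f ∘ g := by
    intro g f
    ext x
    change ite _ _ _ = ite _ _ _
    rw [hG g x]
    rfl
  have hT' : ∀ f ∈ functionsOn F (rankSet hG (A ∪ B)), T f ∈ functionsOn F (rankSet hG B) :=
    fun f _ x hx => if_neg hx
  have hI : ∀ f ∈ functionsOn F (rankSet hG A), (LinearMap.id : Module.End F (L → F)) f ∈
      functionsOn F (rankSet hG (A ∪ B)) := fun f hf x hx => hf x fun h => hx (Or.inl h)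
  refine multiplicityIn_of_exact U (permModuleMap LinearMap.id (fun _ _ => rfl) hI)
    (permModuleMap T hT hT') (permModuleMap_injective _ _ _ fun _ _ h => h) ?_ ?_
  · intro w
    have hw : (permModuleEquiv F G _ w : L → F) ∈ functionsOn F (rankSet hG (A ∪ B)) :=
      fun x hx => (permModuleEquiv F G _ w).2 x fun h => hx (Or.inr h)
    refine ⟨(permModuleEquiv F G _).symm ⟨_, hw⟩, (permModuleEquiv F G _).injective
      (Subtype.ext ?_)⟩
    rw [permModuleEquiv_permModuleMap, LinearEquiv.apply_symm_apply]
    ext x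
    change ite _ _ _ = _
    split_ifs with h
    · rfl
    · exact ((permModuleEquiv F G _ w).2 x h).symm
  · ext v
    rw [LinearMap.mem_range, LinearMap.mem_ker]
    constructor
    · rintro ⟨w, rfl⟩
      refine (permModuleEquiv F G _).map_eq_zero_iff.1 (Subtype.ext ?_)
      rw [permModuleEquiv_permModuleMap, permModuleEquiv_permModuleMap]
      ext x
      change ite _ _ _ = _
      split_ifs with h
      · exact (permModuleEquiv F G _ w).2 x fun h' => Set.disjoint_left.1 hAB h' h
      · rfl
    · intro hv
      have hv' : T (permModuleEquiv F G _ v) = 0 := by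
        rw [← permModuleEquiv_permModuleMap T hT hT', hv, map_zero]
        rfl
      have hvA : (permModuleEquiv F G _ v : L → F) ∈ functionsOn F (rankSet hG A) := by
        intro x hx
        by_cases h : (r x : ℤ) ∈ B
        · have h1 := congrFun hv' x
          change ite _ _ _ = _ at h1
          rwa [if_pos h] at h1
        · exact (permModuleEquiv F G _ v).2 x fun h' => h'.elim hx h
      refine ⟨(permModuleEquiv F G _).symm ⟨_, hvA⟩, (permModuleEquiv F G _).injective
        (Subtype.ext ?_)⟩
      rw [permModuleEquiv_permModuleMap, LinearEquiv.apply_symm_apply]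
      rfl

theorem rankMult_eq_zero {A : Set ℤ} (hA : ∀ x : L, (r x : ℤ) ∉ A) :
    rankMult F G U hG A = 0 := by
  have : Subsingleton (PermModule F G (rankSet hG A)) := by
    refine ⟨fun v w => (permModuleEquiv F G (rankSet hG A)).injective (Subtype.ext (funext ?_))⟩
    intro x
    exact ((permModuleEquiv F G _ v).2 x (hA x)).trans ((permModuleEquiv F G _ w).2 x (hA x)).symm
  exact multiplicityIn_of_subsingleton _ _

end Layers

/-! ### Symmetry and the inequalities -/

section Inequalities

open Finset IsQRank

variable {L : Type*} [Lattice L] [Fintype L] {F : Type*} [Field F]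

open Classical in
theorem sum_filter_comp_orderIso {P : L → L → Prop} (g : L ≃o L)
    (hP : ∀ x y, P (g x) (g y) ↔ P x y) (f : L → F) (y : L) :
    ∑ x with P x y, (f ∘ g) x = ∑ x with P x (g y), f x :=
  sum_equiv g.toEquiv (fun x => by simpa using (hP x y).symm) fun _ _ => rfl

theorem down_comp_orderIso (g : L ≃o L) (f : L → F) : down (f ∘ g) = down f ∘ g :=
  funext fun y => sum_filter_comp_orderIso (P := fun x y => y ⋖ x) g
    (fun _ _ => apply_covBy_apply_iff g) f y

theorem down_pow_comp_orderIso (i : ℕ) (g : L ≃o L) (f : L → F) :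
    (down ^ i) (f ∘ g) = (down ^ i) f ∘ g := by
  induction i with
  | zero => rfl
  | succ i ih =>
    rw [pow_succ', Module.End.mul_apply, Module.End.mul_apply, ih, down_comp_orderIso]

variable {G : Subgroup (L ≃o L)} {U : Type*} [AddCommGroup U] [Module (MonoidAlgebra F G) U]
  [BoundedOrder L] [IsModularLattice L] {r : L → ℕ} {q π : ℕ}

open Classical in
/-- The relation `x ⊓ y = ⊥` embeds the functions on ranks `≥ k` into those on ranks `≤ r ⊤ - k`,
because it forces `r x + r y ≤ r ⊤`. -/
theorem rankMult_Ici_le (hr : IsQRank r q) (hq : (q : F) ≠ 0)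
    (hG : ∀ (g : L ≃o L) x, r (g x) = r x) (k : ℤ) :
    rankMult F G U hG (Set.Ici k) ≤ rankMult F G U hG (Set.Iic (r ⊤ - k)) := by
  let T : Module.End F (L → F) :=
    { toFun := fun f y => ∑ x with x ⊓ y = ⊥, f x
      map_add' := fun f g => funext fun y => sum_add_distrib
      map_smul' := fun a f => funext fun y => (mul_sum _ _ _).symm }
  refine rankMult_le U hG _ _ T (fun g f => funext fun y => sum_filter_comp_orderIso
    (P := fun x y => x ⊓ y = ⊥) g (fun x y => ?_) f y)
    (fun f hf => hr.eq_zero_of_sum_inf_eq_bot hq (congrFun hf)) fun f hf y hy => ?_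
  · rw [← map_inf, map_eq_bot_iff]
  · refine sum_eq_zero fun x hx => hf x fun h => hy ?_
    have h1 := hr.rank_add_rank_le_of_inf_eq_bot (mem_filter.1 hx).2
    rw [Set.mem_Ici] at h
    rw [Set.mem_Iic]
    omega

open Classical in
/-- The reverse inequality, from the relation `x ⊔ y = ⊤`, which forces `r ⊤ ≤ r x + r y`. -/
theorem rankMult_Iic_le (hr : IsQRank r q) (hq : (q : F) ≠ 0)
    (hG : ∀ (g : L ≃o L) x, r (g x) = r x) (k : ℤ) :
    rankMult F G U hG (Set.Iic (r ⊤ - k)) ≤ rankMult F G U hG (Set.Ici k) := by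
  let T : Module.End F (L → F) :=
    { toFun := fun f y => ∑ x with x ⊔ y = ⊤, f x
      map_add' := fun f g => funext fun y => sum_add_distrib
      map_smul' := fun a f => funext fun y => (mul_sum _ _ _).symm }
  refine rankMult_le U hG _ _ T (fun g f => funext fun y => sum_filter_comp_orderIso
    (P := fun x y => x ⊔ y = ⊤) g (fun x y => ?_) f y)
    (fun f hf => hr.eq_zero_of_sum_sup_eq_top hq (congrFun hf)) fun f hf y hy => ?_
  · rw [← map_sup, map_eq_top_iff]
  · refine sum_eq_zero fun x hx => hf x fun h => hy ?_
    have h1 := hr.le_rank_add_rank_of_sup_eq_top (mem_filter.1 hx).2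
    rw [Set.mem_Iic] at h
    rw [Set.mem_Ici]
    omega

theorem rankMult_symm (hr : IsQRank r q) (hq : (q : F) ≠ 0)
    (hG : ∀ (g : L ≃o L) x, r (g x) = r x) (k : ℤ) :
    rankMult F G U hG {k} = rankMult F G U hG {r ⊤ - k} := by
  have h1 : Set.Ici k = {k} ∪ Set.Ici (k + 1) := by
    ext x
    simp only [Set.mem_Ici, Set.mem_union, Set.mem_singleton_iff]
    omega
  have h2 : Set.Iic ((r ⊤ : ℤ) - k) = {(r ⊤ : ℤ) - k} ∪ Set.Iic (r ⊤ - (k + 1)) := by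
    ext x
    simp only [Set.mem_Iic, Set.mem_union, Set.mem_singleton_iff]
    omega
  have h3 := rankMult_union (F := F) (G := G) (U := U) hG (A := {k}) (B := Set.Ici (k + 1))
    (by simp)
  have h4 := rankMult_union (F := F) (G := G) (U := U) hG (A := {(r ⊤ : ℤ) - k})
    (B := Set.Iic (r ⊤ - (k + 1))) (by
      rw [Set.disjoint_singleton_left, Set.mem_Iic]
      omega)
  rw [← h1] at h3
  rw [← h2] at h4
  have h5 := rankMult_Ici_le (F := F) (G := G) (U := U) hr hq hG k
  have h6 := rankMult_Iic_le (F := F) (G := G) (U := U) hr hq hG k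
  have h7 := rankMult_Ici_le (F := F) (G := G) (U := U) hr hq hG (k + 1)
  have h8 := rankMult_Iic_le (F := F) (G := G) (U := U) hr hq hG (k + 1)
  omega

/-- The multiplicities `κ k` in the kernel and `ι k` in the image of `down` on the functions of
rank `k`: where the homology vanishes, the multiplicity at rank `k - 1` is made up of `ι k` and
of a part embedding into the kernel of `down` at rank `k - π`. -/
theorem exists_rankMult_decomposition (hr : IsQRank r q) (hq : (q : F) ≠ 0) (hπ : 0 < π)
    (h0 : ∑ l ∈ range π, (q : F) ^ l = 0)
    (h1 : ∀ i, 0 < i → i < π → ∑ l ∈ range i, (q : F) ^ l ≠ 0)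
    (hG : ∀ (g : L ≃o L) x, r (g x) = r x) :
    ∃ κ ι : ℤ → ℕ, (∀ k, rankMult F G U hG {k} = κ k + ι k) ∧
      ∀ k : ℤ, ((r ⊤ : ℤ) + π ≤ 2 * k - 1 ∨ 2 * k - 1 ≤ r ⊤) →
        rankMult F G U hG {k - 1} ≤ ι k + κ (k - π) := by
  have hd : ∀ k : ℤ, ∀ f ∈ functionsOn F (rankSet hG {k}),
      down f ∈ functionsOn F (rankSet hG {k - 1}) := fun k f hf => hr.down_mem_ofRank hf
  let d : ∀ k : ℤ, PermModule F G (rankSet hG {k}) →ₗ[MonoidAlgebra F G]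
      PermModule F G (rankSet hG {k - 1}) := fun k => permModuleMap down down_comp_orderIso (hd k)
  refine ⟨fun k => multiplicityIn (MonoidAlgebra F G) (LinearMap.ker (d k)) U,
    fun k => multiplicityIn (MonoidAlgebra F G) (LinearMap.range (d k)) U,
    fun k => multiplicityIn_eq_ker_add_range U (d k), fun k hk => ?_⟩
  have he : ∀ f ∈ functionsOn F (rankSet hG {k - 1}),
      (down ^ (π - 1)) f ∈ functionsOn F (rankSet hG {k - π}) := by
    intro f hf
    have h2 := hr.down_pow_mem_ofRank (k := k - 1) hf (π - 1)
    rwa [show k - 1 - ((π - 1 : ℕ) : ℤ) = k - π by omega] at h2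
  let e : PermModule F G (rankSet hG {k - 1}) →ₗ[MonoidAlgebra F G]
      PermModule F G (rankSet hG {k - π}) :=
    permModuleMap (down ^ (π - 1)) (down_pow_comp_orderIso (π - 1)) he
  rw [rankMult, multiplicityIn_eq_ker_add_range U e]
  refine add_le_add (multiplicityIn_mono U ?_) (multiplicityIn_mono U ?_)
  · intro v hv
    have hv' : (down ^ (π - 1)) (permModuleEquiv F G _ v : L → F) = 0 := by
      rw [← permModuleEquiv_permModuleMap _ (down_pow_comp_orderIso (π - 1)) he,
        LinearMap.mem_ker.1 hv, map_zero]
      rfl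
    obtain ⟨g, -, hg, hgv⟩ := hr.exactBelow hq h0 h1 ⊤ (k - 1) (π - 1) 1 (by omega) (by omega)
      (permModuleEquiv F G _ v : L → F) (fun x hx => absurd le_top hx)
      (permModuleEquiv F G _ v).2 hv'
    rw [Nat.cast_one, sub_add_cancel] at hg
    refine ⟨(permModuleEquiv F G _).symm ⟨g, hg⟩, (permModuleEquiv F G _).injective
      (Subtype.ext ?_)⟩
    rw [permModuleEquiv_permModuleMap, LinearEquiv.apply_symm_apply, ← hgv, pow_one]
  · rintro _ ⟨v, rfl⟩
    refine LinearMap.mem_ker.2 ((permModuleEquiv F G _).map_eq_zero_iff.1 (Subtype.ext ?_))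
    rw [permModuleEquiv_permModuleMap, permModuleEquiv_permModuleMap, ← Module.End.mul_apply,
      ← pow_succ', Nat.sub_add_cancel hπ, hr.down_pow_eq_zero hπ h0]
    rfl

theorem finite_support_comp_add_mul {c : ℤ → ℤ} {n : ℕ} (hπ : 0 < π)
    (hc : ∀ k, c k ≠ 0 → 0 ≤ k ∧ k ≤ n) (a : ℤ) :
    (Function.support fun t : ℤ => c (a + t * π)).Finite := by
  have h : Function.Injective fun t : ℤ => a + t * π := fun s t hst => by
    have := mul_right_cancel₀ (Nat.cast_ne_zero.2 hπ.ne') (add_left_cancel hst)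
    exact this
  refine Set.Finite.subset ((Set.finite_Icc (0 : ℤ) n).preimage h.injOn) fun t ht => hc _ ht

/-- Summing the inequalities of `exists_rankMult_decomposition` over a residue class, the kernel
parts and the image parts recombine. -/
theorem periodSum_le_of_decomposition {c κ ι : ℤ → ℕ} {n : ℕ} (hπ : 0 < π)
    (hc : ∀ k, c k ≠ 0 → 0 ≤ k ∧ k ≤ n) (hd : ∀ k, c k = κ k + ι k) (a : ℤ)
    (h : ∀ t : ℤ, c (a + t * π - 1) ≤ ι (a + t * π) + κ (a + t * π - π)) :
    periodSum (fun k => (c k : ℤ)) π (a - 1) ≤ periodSum (fun k => (c k : ℤ)) π a := by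
  have hfin : ∀ f : ℤ → ℕ, (∀ k, f k ≤ c k) → ∀ b : ℤ,
      (Function.support fun t : ℤ => (f (b + t * π) : ℤ)).Finite := fun f hf b =>
    finite_support_comp_add_mul (c := fun k => (f k : ℤ)) hπ (fun k hk => hc k (by
      have := hf k
      omega)) b
  have hκ := hfin κ fun k => by have := hd k; omega
  have hι := hfin ι fun k => by have := hd k; omega
  have h1 : periodSum (fun k => (c k : ℤ)) π a =
      ∑ᶠ t : ℤ, (ι (a + t * π) : ℤ) + ∑ᶠ t : ℤ, (κ (a + t * π) : ℤ) := by
    rw [← finsum_add_distrib (hι a) (hκ a), periodSum]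
    refine finsum_congr fun t => ?_
    rw [hd]
    push_cast
    ring
  have h2 : ∑ᶠ t : ℤ, (κ (a + t * π) : ℤ) = ∑ᶠ t : ℤ, (κ (a - π + t * π) : ℤ) := by
    rw [← finsum_comp_equiv (Equiv.subRight (1 : ℤ)) (f := fun t => (κ (a + t * π) : ℤ))]
    refine finsum_congr fun t => ?_
    rw [Equiv.subRight_apply]
    congr 2
    ring
  rw [h1, h2, ← finsum_add_distrib (hι a) (hκ _), periodSum]
  refine finsum_le_finsum' (hfin c (fun _ => le_rfl) _) ?_ fun t => ?_
  · exact ((hι a).union (hκ (a - π))).subset (Function.support_add _ _)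
  · have h3 := h t
    rw [show a + t * π - 1 = a - 1 + t * π by ring,
      show a + t * π - (π : ℤ) = a - π + t * π by ring] at h3
    change ((c _ : ℕ) : ℤ) ≤ (ι _ : ℤ) + (κ _ : ℤ)
    exact_mod_cast h3

/-- The multiplicities of the two posets satisfy the same symmetry and inequalities, for every
`π` with vanishing `q`-integer and no smaller such positive number. For `π = 0` the inequalities
between periodic sums are void, as there is no `j < π / 2`. -/
theorem rankMult_inequalities (hr : IsQRank r q) (hq : (q : F) ≠ 0)
    (h0 : ∑ l ∈ range π, (q : F) ^ l = 0)
    (h1 : ∀ i, 0 < i → i < π → ∑ l ∈ range i, (q : F) ^ l ≠ 0)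
    (hG : ∀ (g : L ≃o L) x, r (g x) = r x) {n : ℕ} (hn : r ⊤ = n) {c : ℤ → ℤ}
    (hc : ∀ k, c k = rankMult F G U hG {k}) :
    (∀ k : ℤ, c k = c (n - k)) ∧
    (∀ j : ℕ, j < π / 2 →
      periodSum c π ((n / 2 : ℕ) - (j + 1 : ℤ)) ≤ periodSum c π ((n / 2 : ℕ) - (j : ℤ))) ∧
    0 ≤ periodSum c π ((n / 2 : ℕ) - ((π / 2 : ℕ) : ℤ)) ∧
    (n < π → (∀ k : ℤ, 0 ≤ k → k ≤ n → periodSum c π k = c k) ∧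
      ∀ k l : ℤ, k ≤ l → k + l ≤ n → c k ≤ c l) := by
  subst hn
  obtain rfl : c = fun k => (rankMult F G U hG {k} : ℤ) := funext hc
  have hsymm : ∀ k : ℤ, (rankMult F G U hG {k} : ℤ) = rankMult F G U hG {r ⊤ - k} :=
    fun k => congrArg _ (rankMult_symm hr hq hG k)
  have hsupp : ∀ k : ℤ, rankMult F G U hG {k} ≠ 0 → 0 ≤ k ∧ k ≤ r ⊤ := by
    intro k hk
    by_contra h
    refine hk (rankMult_eq_zero U hG fun x hx => h ?_)
    have h2 := hr.rank_le_top x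
    rw [Set.mem_singleton_iff] at hx
    omega
  have hineq : ∀ j : ℕ, j < π / 2 →
      periodSum (fun k => (rankMult F G U hG {k} : ℤ)) π ((r ⊤ / 2 : ℕ) - (j + 1 : ℤ)) ≤
        periodSum (fun k => (rankMult F G U hG {k} : ℤ)) π ((r ⊤ / 2 : ℕ) - (j : ℤ)) := by
    intro j hj
    have hπ : 0 < π := by omega
    obtain ⟨κ, ι, hd, h2⟩ := exists_rankMult_decomposition (G := G) (U := U) hr hq hπ h0 h1 hG
    rw [← sub_sub]
    refine periodSum_le_of_decomposition hπ hsupp hd _ fun t => h2 _ ?_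
    -- In the residue class of `k = ⌊n / 2⌋ - j` modulo `π`, every `k ≤ ⌊n / 2⌋` satisfies
    -- `2 * k - 1 ≤ n`, and every larger `k` is at least `⌊n / 2⌋ - j + π` with `j < ⌊π / 2⌋`,
    -- so `n + π ≤ 2 * k - 1`: the homology at rank `k - 1` vanishes.
    rcases lt_or_ge 0 t with ht | ht
    · left
      have : (π : ℤ) ≤ t * π := le_mul_of_one_le_left (by positivity) ht
      omega
    · right
      have : t * π ≤ 0 := mul_nonpos_of_nonpos_of_nonneg ht (by positivity)
      omega
  refine ⟨hsymm, hineq, finsum_nonneg fun t => Nat.cast_nonneg _, fun hn => ?_⟩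
  have hper : ∀ k : ℤ, 0 ≤ k → k ≤ r ⊤ →
      periodSum (fun k => (rankMult F G U hG {k} : ℤ)) π k = rankMult F G U hG {k} := by
    intro k hk hk'
    rw [periodSum, finsum_eq_single _ 0 fun t ht => ?_, zero_mul, add_zero]
    by_contra h
    have h2 := hsupp _ (Nat.cast_ne_zero.1 h)
    rcases lt_or_gt_of_ne ht with ht | ht
    · have : t * π ≤ -1 * π := mul_le_mul_of_nonneg_right (by omega) (by positivity)
      omega
    · have : (π : ℤ) ≤ t * π := le_mul_of_one_le_left (by positivity) ht
      omega
  refine ⟨hper, ?_⟩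
  -- As `n < π`, the periodic sums at `k ≥ 0` are single terms, and the chain of inequalities
  -- covers all ranks from `0` to `⌊n / 2⌋`.
  have hstep : ∀ d : ℕ, ∀ l : ℤ, l ≤ (r ⊤ / 2 : ℕ) →
      (rankMult F G U hG {l - d} : ℤ) ≤ rankMult F G U hG {l} := by
    intro d l hl
    induction d with
    | zero => simp
    | succ d ih =>
      refine le_trans ?_ ih
      by_cases h : 0 ≤ l - (d + 1 : ℕ)
      · have h2 := hineq ((r ⊤ / 2 : ℕ) - (l - d)).toNat (by omega)
        rw [show ((((r ⊤ / 2 : ℕ) - (l - d)).toNat : ℕ) : ℤ) = (r ⊤ / 2 : ℕ) - (l - d) by omega,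
          sub_sub_cancel, show ((r ⊤ / 2 : ℕ) : ℤ) - ((r ⊤ / 2 : ℕ) - (l - d) + 1) =
            l - (d + 1 : ℕ) by push_cast; ring, hper _ (by omega) (by omega),
          hper _ (by omega) (by omega)] at h2
        exact h2
      · rw [show rankMult F G U hG {l - ((d + 1 : ℕ) : ℤ)} = 0 from
          by_contra fun h' => h (hsupp _ h').1]
        exact Nat.cast_nonneg _
  intro k l hkl hkl'
  by_cases hl : l ≤ (r ⊤ / 2 : ℕ)
  · have h2 := hstep (l - k).toNat l hl
    rwa [show l - ((l - k).toNat : ℤ) = k by omega] at h2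
  · have h2 := hstep (r ⊤ - l - k).toNat (r ⊤ - l) (by omega)
    rw [show (r ⊤ : ℤ) - l - ((r ⊤ - l - k : ℤ).toNat : ℤ) = k by omega] at h2
    exact h2.trans (hsymm l).ge

end Inequalities

/-! ### The two posets -/

/-- In a Boolean lattice the only cover of `y` below `W` but not below the hyperplane `H` of `W`
is `y` together with the point of `W` outside `H`. -/
theorem isQRank_card (Ω : Type*) [Fintype Ω] [DecidableEq Ω] :
    IsQRank (Finset.card : Finset Ω → ℕ) 1 where
  strictMono := Finset.card_strictMono
  map_bot := Finset.card_empty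
  covBy h := (Nat.covBy_iff_add_one_eq.1 h.card_finset).symm
  ncard_covers {y H W} hy hH := by
    obtain ⟨a, ha, rfl⟩ := Finset.covBy_iff_exists_insert.1 hH
    rw [one_pow, Set.ncard_eq_one]
    refine ⟨insert a y, ?_⟩
    ext x
    rw [Set.mem_singleton_iff]
    constructor
    · rintro ⟨h1, h2, h3⟩
      obtain ⟨b, hb, rfl⟩ := Finset.covBy_iff_exists_insert.1 h1
      have hbH : b ∉ H := fun h => h3 (Finset.insert_subset h hy)
      have := (Finset.mem_insert.1 (h2 (Finset.mem_insert_self b y))).resolve_right hbH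
      rw [this]
    · rintro rfl
      refine ⟨Finset.covBy_insert fun h => ha (hy h), Finset.insert_subset_insert a hy,
        fun h => ha (h (Finset.mem_insert_self a y))⟩

section Subspaces

variable {K V : Type*} [Field K] [AddCommGroup V] [Module K V] [FiniteDimensional K V]

theorem finrank_eq_of_covBy {x y : Submodule K V} (h : x ⋖ y) :
    Module.finrank K y = Module.finrank K x + 1 := by
  obtain ⟨v, hvy, hvx⟩ := SetLike.exists_of_lt h.lt
  have h1 := Submodule.covBy_span_singleton_sup hvx
  have h2 : K ∙ v ⊔ x = y := (h.eq_or_eq h1.le (sup_le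
    ((Submodule.span_singleton_le_iff_mem v y).2 hvy) h.le)).resolve_left h1.ne'
  have hv : v ≠ 0 := fun h => hvx (h ▸ x.zero_mem)
  have h3 := Submodule.finrank_sup_add_finrank_inf_eq (K ∙ v) x
  rw [h2, finrank_span_singleton hv, (Submodule.disjoint_span_singleton' hv).2 hvx |>.symm.eq_bot,
    finrank_bot] at h3
  omega

open Classical in
theorem card_mem_and_notMem [Fintype V] {x y : Submodule K V} (h : x ⋖ y) :
    Finset.card {v : V | v ∈ y ∧ v ∉ x} = Nat.card K ^ Module.finrank K x * (Nat.card K - 1) := by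
  have h1 : ∀ z : Submodule K V, Finset.card {v : V | v ∈ z} = Nat.card K ^ Module.finrank K z := by
    intro z
    rw [← Module.natCard_eq_pow_finrank, Nat.card_eq_fintype_card, Fintype.card_subtype]
  rw [Nat.mul_sub_one, ← pow_succ, ← finrank_eq_of_covBy h, ← h1, ← h1,
    ← Finset.card_sdiff_of_subset (fun v hv => by
      rw [Finset.mem_filter] at hv ⊢
      exact ⟨hv.1, h.le hv.2⟩)]
  congr 1
  ext v
  simp

variable [Finite K]

open Classical in
/-- The vectors of `W` outside `H` are partitioned by the subspaces that they span together
with `y`. -/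
theorem isQRank_finrank :
    IsQRank (fun x : Submodule K V => Module.finrank K x) (Nat.card K) where
  strictMono _ _ h := Submodule.finrank_lt_finrank_of_lt h
  map_bot := finrank_bot K V
  covBy h := finrank_eq_of_covBy h
  ncard_covers {y H W} hy hH := by
    have : Finite V := Module.finite_of_finite K
    have := Fintype.ofFinite V
    have := Fintype.ofFinite (Submodule K V)
    have hmap : ∀ v ∈ ({v : V | v ∈ W ∧ v ∉ H} : Finset V), K ∙ v ⊔ y ∈
        ({x : Submodule K V | y ⋖ x ∧ x ≤ W ∧ ¬ x ≤ H} : Finset (Submodule K V)) := by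
      intro v hv
      obtain ⟨-, hvW, hvH⟩ := Finset.mem_filter.1 hv
      refine Finset.mem_filter.2 ⟨Finset.mem_univ _, Submodule.covBy_span_singleton_sup
        fun h => hvH (hy h), sup_le ((Submodule.span_singleton_le_iff_mem v W).2 hvW)
        (hy.trans hH.le), fun h => hvH ?_⟩
      exact (Submodule.span_singleton_le_iff_mem v H).1 (le_sup_left.trans h)
    have h1 := Finset.card_eq_sum_card_fiberwise hmap
    have h2 : ∀ x ∈ ({x : Submodule K V | y ⋖ x ∧ x ≤ W ∧ ¬ x ≤ H} : Finset (Submodule K V)),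
        Finset.card ({v ∈ ({v : V | v ∈ W ∧ v ∉ H} : Finset V) | K ∙ v ⊔ y = x}) =
          Nat.card K ^ Module.finrank K y * (Nat.card K - 1) := by
      intro x hx
      obtain ⟨-, h3, h4, h5⟩ := Finset.mem_filter.1 hx
      rw [← card_mem_and_notMem h3, Finset.filter_filter]
      refine congrArg Finset.card (Finset.filter_congr fun v _ => ⟨?_, ?_⟩)
      · rintro ⟨⟨hvW, hvH⟩, rfl⟩
        exact ⟨(Submodule.span_singleton_le_iff_mem v _).1 le_sup_left, fun h => hvH (hy h)⟩
      · rintro ⟨hvx, hvy⟩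
        have h6 := Submodule.covBy_span_singleton_sup hvy
        refine ⟨⟨h4 hvx, fun hvH => hvy ?_⟩, (h3.eq_or_eq h6.le (sup_le
          ((Submodule.span_singleton_le_iff_mem v x).2 hvx) h3.le)).resolve_left h6.ne'⟩
        rw [← (IsQRank.covBy_iff_inf_eq hH h4 h5 hy).1 h3]
        exact ⟨hvx, hvH⟩
    rw [card_mem_and_notMem hH, Finset.sum_congr rfl h2, Finset.sum_const, smul_eq_mul,
      ← mul_assoc] at h1
    have hK : 1 < Nat.card K := Finite.one_lt_card
    have h3 := Nat.eq_of_mul_eq_mul_right (Nat.sub_pos_of_lt hK) h1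
    rw [Set.ncard_eq_toFinset_card', Set.toFinset_ofPred]
    refine Nat.eq_of_mul_eq_mul_right (pow_pos (zero_lt_one.trans hK) (Module.finrank K y)) ?_
    rw [← h3, ← pow_add, Nat.sub_add_cancel (Submodule.finrank_mono hy)]

end Subspaces

theorem mainTheorem1 {F : Type*} [Field F] (p : ℕ) (hp : p.Prime) [CharP F p] (n : ℕ) :
    -- the Boolean lattice of an n-set, with π = p
    (∀ (Ω : Type*) [Fintype Ω], Fintype.card Ω = n →
      ∀ (G : Subgroup (Finset Ω ≃o Finset Ω))
        (U : Type*) [AddCommGroup U] [Module (MonoidAlgebra F G) U]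
        [IsSimpleModule (MonoidAlgebra F G) U],
      (∀ k : ℤ, subsetMult F G U k = subsetMult F G U (n - k)) ∧
      (∀ j : ℕ, j < p / 2 →
        periodSum (subsetMult F G U) p ((n / 2 : ℕ) - (j + 1 : ℤ)) ≤
          periodSum (subsetMult F G U) p ((n / 2 : ℕ) - (j : ℤ))) ∧
      0 ≤ periodSum (subsetMult F G U) p ((n / 2 : ℕ) - ((p / 2 : ℕ) : ℤ)) ∧
      (n < p →
        (∀ k : ℤ, 0 ≤ k → k ≤ n → periodSum (subsetMult F G U) p k = subsetMult F G U k) ∧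
        ∀ k l : ℤ, k ≤ l → k + l ≤ n → subsetMult F G U k ≤ subsetMult F G U l)) ∧
    -- the projective space of an n-dimensional space over the field of q elements, π = π(p,q)
    (∀ (q : ℕ) (K : Type*) [Field K] [Finite K], Nat.card K = q → Nat.Coprime p q →
      ∀ (V : Type*) [AddCommGroup V] [Module K V] [FiniteDimensional K V],
      Module.finrank K V = n →
      ∀ (G : Subgroup (Submodule K V ≃o Submodule K V))
        (U : Type*) [AddCommGroup U] [Module (MonoidAlgebra F G) U]
        [IsSimpleModule (MonoidAlgebra F G) U],
      (∀ k : ℤ, subspaceMult F G U k = subspaceMult F G U (n - k)) ∧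
      (∀ j : ℕ, j < quantumChar p q / 2 →
        periodSum (subspaceMult F G U) (quantumChar p q) ((n / 2 : ℕ) - (j + 1 : ℤ)) ≤
          periodSum (subspaceMult F G U) (quantumChar p q) ((n / 2 : ℕ) - (j : ℤ))) ∧
      0 ≤ periodSum (subspaceMult F G U) (quantumChar p q)
        ((n / 2 : ℕ) - ((quantumChar p q / 2 : ℕ) : ℤ)) ∧
      (n < quantumChar p q →
        (∀ k : ℤ, 0 ≤ k → k ≤ n →
          periodSum (subspaceMult F G U) (quantumChar p q) k = subspaceMult F G U k) ∧
        ∀ k l : ℤ, k ≤ l → k + l ≤ n → subspaceMult F G U k ≤ subspaceMult F G U l)) := by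
  constructor
  · intro Ω _ hΩ G U _ _ _
    classical
    have h1 : ∀ i : ℕ, ∑ l ∈ Finset.range i, ((1 : ℕ) : F) ^ l = i := by simp
    refine rankMult_inequalities (F := F) (G := G) (U := U) (π := p) (isQRank_card Ω)
      (by rw [Nat.cast_one]; exact one_ne_zero) (by rw [h1, CharP.cast_eq_zero])
      (fun i hi hip h => ?_) card_orderIso_apply
      (by rw [Finset.top_eq_univ, Finset.card_univ, hΩ]) fun k => ?_
    · rw [h1, CharP.cast_eq_zero_iff F p] at h
      exact (Nat.le_of_dvd hi h).not_gt hip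
    · rfl
  · intro q K _ _ hK hpq V _ _ _ hV G U _ _ _
    have : Finite V := Module.finite_of_finite K
    have := Fintype.ofFinite (Submodule K V)
    subst hK
    have h1 : ∀ i : ℕ, ∑ l ∈ Finset.range i, ((Nat.card K : ℕ) : F) ^ l = 0 ↔
        p ∣ ∑ l ∈ Finset.range i, Nat.card K ^ l := by
      intro i
      rw [← CharP.cast_eq_zero_iff F p]
      push_cast
      rfl
    refine rankMult_inequalities (F := F) (G := G) (U := U) (π := quantumChar p (Nat.card K))
      isQRank_finrank ?_ ?_ (fun i hi hip h => ?_) finrank_orderIso_apply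
      (by rw [finrank_top, hV]) fun k => ?_
    · rw [Ne, CharP.cast_eq_zero_iff F p]
      exact (Nat.Prime.coprime_iff_not_dvd hp).1 hpq
    -- If no `i` qualified, the infimum would be `0`, for which the sum is empty.
    · rcases Nat.eq_zero_or_pos (quantumChar p (Nat.card K)) with h | h
      · rw [h, Finset.range_zero, Finset.sum_empty]
      · exact (h1 _).2 (Nat.sInf_mem (Nat.nonempty_of_pos_sInf h)).2
    · exact Nat.notMem_of_lt_sInf hip ⟨hi, (h1 i).1 h⟩
    · rfl
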